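/- Let $p$ be a prime number and let $X$ be a compact 3-manifold (topological, Hausdorff, possibly with boundary). Let $(X_{p^n}\to X)_{n\ge 0}$ be a $\mathbb{Z}_p$-cover of $X$, that is, a system of connected regular covers $X_{p^n}\to X$ with covering group $\mathbb{Z}/p^n\mathbb{Z}$ which is compatible in the sense that for every $n$ the map $X_{p^{n+1}}\to X$ factors through $X_{p^n}\to X$. For each $n$, let $H_1(X_{p^n})$ be the first singular homology group with coefficients in $\mathbb{Z}$, let $H_1(X_{p^n})_{\rm tor}$ be its torsion subgroup, let $H_1(X_{p^n})_{\text{non-}p}$ be the subgroup of elements of finite order prime to $p$, and for a prime number $l$ let $H_1(X_{p^n})_{(l)}$ be the subgroup of elements of $l$-power order. Then all these subgroups are finite, and, as $n\to\infty$, each of the sequences of orders $(|H_1(X_{p^n})_{\rm tor}|)_n$, $(|H_1(X_{p^n})_{\text{non-}p}|)_n$ and, for every prime number $l$ (including $l=p$), $(|H_1(X_{p^n})_{(l)}|)_n$ converges in the ring $\mathbb{Z}_p$ of $p$-adic integers. -/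

import Mathlib

open Filter Topology

universe u

/-- A `ℤ_p`-cover of a space `X`: a compatible system of connected regular covers `X_{p^n} → X`
with group `ℤ/p^n`, for `n ≥ 0`. Regularity with the given group says that `ℤ/p^n` acts freely and
properly discontinuously on `X_{p^n}` and that the projection is the quotient map.
Compatibility says that `X_{p^{n+1}} → X` factors through `X_{p^n} → X`; as the covers are
connected, the factoring maps are then automatically equivariant along some surjection
`ℤ/p^{n+1} → ℤ/p^n`, so that no compatibility of the chosen generators has to be required. -/
structure ZpCover (p : ℕ) (X : Type u) [TopologicalSpace X] where
  /-- the `n`-th layer `X_{p^n}` -/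
  space : ℕ → TopCat.{u}
  connected : ∀ n, ConnectedSpace (space n)
  /-- the covering projection `X_{p^n} → X` -/
  proj : ∀ n, C(space n, X)
  /-- the action of the covering group -/
  action : ∀ n, AddAction (ZMod (p ^ n)) (space n)
  isCover : ∀ n, IsAddQuotientCoveringMap (proj n) (ZMod (p ^ n))
  /-- the transition maps `X_{p^{n+1}} → X_{p^n}` -/
  trans : ∀ n, C(space (n + 1), space n)
  proj_trans : ∀ n, (proj n).comp (trans n) = proj (n + 1)

/-- The first singular homology group `H_1(Y; ℤ)`. -/
noncomputable abbrev H1 (Y : TopCat.{u}) : ModuleCat.{u} ℤ :=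
  ((AlgebraicTopology.singularHomologyFunctor (ModuleCat.{u} ℤ) 1).obj
    (ModuleCat.of ℤ (ULift.{u} ℤ))).obj Y

/-- The non-`p` torsion subgroup: the elements of finite order prime to `p`
(for `p ≠ 1`, elements of infinite order have `addOrderOf x = 0` and are excluded). -/
def nonPTorsion (A : Type u) [AddCommGroup A] (p : ℕ) : AddSubgroup A where
  carrier := {x | (addOrderOf x).Coprime p}
  zero_mem' := by simp
  add_mem' {x y} hx hy :=
    (Nat.Coprime.mul_left hx hy).coprime_dvd_left
      (AddCommute.addOrderOf_add_dvd_mul_addOrderOf (AddCommute.all x y))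
  neg_mem' {x} hx := by simpa using hx

/-!
Write `X_n` for the `n`-th layer and choose a point of `X`. Singular `1`-chains of `X_n` modulo
boundaries, restricted to the chains whose boundary lies over the chosen point, form a finitely
generated group `D_n` with the same torsion as `H_1(X_n)`. Unlike `H_1`, these groups satisfy
exact descent: since paths and triangles lift, `D_n` is the group of coinvariants of `D_{n+1}`
under the subgroup of order `p` of the covering group.

The torsion of order prime to `p` in `D_n` corresponds to the fixed points of that subgroup in the
corresponding torsion of `D_{n+1}`. All other elements lie in free orbits of the cyclic group of
order `p ^ (n + 1)`, so successive orders are congruent modulo `p ^ (n + 1)`.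

For the `p`-part, `ℤ_p ⊗ D_n` is the layer `E / ω_n E` of a finitely generated `ℤ_p⟦X⟧`-module `E`,
`ω_n = (1 + X) ^ p ^ n - 1`. After division by the largest finite submodule of `p`-power torsion,
multiplication by `ω_{n+1} / ω_n` is injective for large `n`, so the orders of the `p`-primary parts
are an eventually nondecreasing sequence of powers of `p`, which converges in `ℤ_p`.
-/

/-! ### Torsion with respect to a monoid of natural numbers -/

/-- The multiplicative monoid of natural numbers prime to `p`; its torsion is `nonPTorsion`. -/
def coprimeSubmonoid (p : ℕ) : Submonoid ℕ where
  carrier := {m | m.Coprime p}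
  one_mem' := Nat.coprime_one_left p
  mul_mem' := Nat.Coprime.mul_left

section Torsion

open Submodule

variable {A B : Type*} [AddCommGroup A] [AddCommGroup B] {S : Submonoid ℕ}

theorem mem_torsion'_submonoid_iff {x : A} : x ∈ torsion' ℤ A S ↔ ∃ m ∈ S, m • x = 0 :=
  ⟨fun ⟨m, hm⟩ => ⟨m, m.2, hm⟩, fun ⟨m, hm, hx⟩ => ⟨⟨m, hm⟩, hx⟩⟩

theorem map_mem_torsion' (f : A →ₗ[ℤ] B) {x : A} (hx : x ∈ torsion' ℤ A S) :
    f x ∈ torsion' ℤ B S := by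
  obtain ⟨m, hm, hx⟩ := mem_torsion'_submonoid_iff.1 hx
  exact mem_torsion'_submonoid_iff.2 ⟨m, hm, by rw [← map_nsmul, hx, map_zero]⟩

variable (A)

theorem mem_torsion_of_nsmul_eq_zero {x : A} {m : ℕ} (hm : m ≠ 0) (hx : m • x = 0) :
    x ∈ AddCommGroup.torsion A :=
  isOfFinAddOrder_iff_nsmul_eq_zero.2 ⟨m, Nat.pos_of_ne_zero hm, hx⟩

theorem torsion'_nonZeroDivisors :
    (torsion' ℤ A (nonZeroDivisors ℕ)).toAddSubgroup = AddCommGroup.torsion A := by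
  ext x
  refine mem_torsion'_submonoid_iff.trans (Iff.trans ?_ isOfFinAddOrder_iff_nsmul_eq_zero.symm)
  simp only [mem_nonZeroDivisors_iff_ne_zero, Nat.pos_iff_ne_zero]

theorem torsion'_coprimeSubmonoid (p : ℕ) :
    (torsion' ℤ A (coprimeSubmonoid p)).toAddSubgroup = nonPTorsion A p := by
  ext x
  refine mem_torsion'_submonoid_iff.trans ⟨fun ⟨m, hm, hx⟩ => ?_, fun hx => ?_⟩
  · exact Nat.Coprime.coprime_dvd_left (addOrderOf_dvd_of_nsmul_eq_zero hx) hm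
  · exact ⟨addOrderOf x, hx, addOrderOf_nsmul_eq_zero x⟩

theorem torsion'_powers (l : ℕ) :
    (torsion' ℤ A (Submonoid.powers l)).toAddSubgroup = AddCommGroup.primaryComponent A l := by
  ext x
  exact mem_torsion'_submonoid_iff.trans Set.exists_range_iff

theorem torsion'_le_torsion (hS : 0 ∉ S) :
    (torsion' ℤ A S).toAddSubgroup ≤ AddCommGroup.torsion A := by
  intro x hx
  obtain ⟨m, hm, hx⟩ := mem_torsion'_submonoid_iff.1 hx
  exact mem_torsion_of_nsmul_eq_zero A (ne_of_mem_of_not_mem hm hS) hx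

theorem zero_notMem_of_le_coprimeSubmonoid {p : ℕ} (hp : p ≠ 1) (hS : S ≤ coprimeSubmonoid p) :
    0 ∉ S := fun h => hp ((Nat.coprime_zero_left p).1 (hS h))

theorem disjoint_nonPTorsion_primaryComponent (p : ℕ) :
    Disjoint (nonPTorsion A p) (AddCommGroup.primaryComponent A p) := by
  rw [AddSubgroup.disjoint_def]
  rintro x hx ⟨k, hk⟩
  exact AddMonoid.addOrderOf_eq_one_iff.1 <|
    Nat.eq_one_of_dvd_coprimes (Nat.Coprime.pow_right k hx) dvd_rfl
      (addOrderOf_dvd_of_nsmul_eq_zero hk)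

theorem nonPTorsion_le_torsion {p : ℕ} (hp : p ≠ 1) : nonPTorsion A p ≤ AddCommGroup.torsion A :=
  torsion'_coprimeSubmonoid A p ▸
    torsion'_le_torsion A (zero_notMem_of_le_coprimeSubmonoid hp le_rfl)

theorem primaryComponent_le_torsion {p : ℕ} (hp : p ≠ 0) :
    AddCommGroup.primaryComponent A p ≤ AddCommGroup.torsion A := by
  rintro x ⟨k, hk⟩
  exact mem_torsion_of_nsmul_eq_zero A (pow_ne_zero k hp) hk

theorem torsion_le_nonPTorsion_sup_primaryComponent {p : ℕ} (hp : p.Prime) :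
    AddCommGroup.torsion A ≤ nonPTorsion A p ⊔ AddCommGroup.primaryComponent A p := by
  intro x hx
  obtain ⟨n, hn, hnx⟩ := isOfFinAddOrder_iff_nsmul_eq_zero.1 hx
  obtain ⟨k, m, hm, rfl⟩ := Nat.exists_eq_pow_mul_and_not_dvd hn.ne' p hp.ne_one
  have hmp : m.Coprime p := ((Nat.Prime.coprime_iff_not_dvd hp).2 hm).symm
  obtain ⟨a, b, hab⟩ : IsCoprime ((p ^ k : ℕ) : ℤ) m :=
    Nat.isCoprime_iff_coprime.2 (hmp.symm.pow_left k)
  refine AddSubgroup.mem_sup.2 ⟨a • p ^ k • x, ?_, b • m • x, ⟨k, ?_⟩, ?_⟩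
  · refine hmp.coprime_dvd_left (addOrderOf_dvd_of_nsmul_eq_zero ?_)
    rw [smul_comm, ← mul_smul m, mul_comm, hnx, smul_zero]
  · rw [smul_comm, ← mul_smul (p ^ k), hnx, smul_zero]
  · rw [← natCast_zsmul, ← natCast_zsmul, ← mul_smul, ← mul_smul, ← add_smul, hab, one_smul]

theorem card_torsion_eq_card_nonPTorsion_mul {p : ℕ} (hp : p.Prime) :
    Nat.card (AddCommGroup.torsion A) =
      Nat.card (nonPTorsion A p) * Nat.card (AddCommGroup.primaryComponent A p) := by
  rw [← Nat.card_prod]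
  refine (Nat.card_congr <| Equiv.ofBijective
    (fun x => ⟨(x.1 : A) + x.2, add_mem (nonPTorsion_le_torsion A hp.ne_one x.1.2)
      (primaryComponent_le_torsion A hp.ne_zero x.2.2)⟩) ⟨fun x y hxy => ?_, ?_⟩).symm
  · exact AddSubgroup.add_injective_of_disjoint (disjoint_nonPTorsion_primaryComponent A p)
      (Subtype.mk.inj hxy)
  · rintro ⟨x, hx⟩
    obtain ⟨y, hy, z, hz, rfl⟩ :=
      AddSubgroup.mem_sup.1 (torsion_le_nonPTorsion_sup_primaryComponent A hp hx)
    exact ⟨(⟨y, hy⟩, ⟨z, hz⟩), rfl⟩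

theorem exists_card_primaryComponent_eq_pow {p : ℕ} [Fact p.Prime]
    [Finite (AddCommGroup.primaryComponent A p)] :
    ∃ k, Nat.card (AddCommGroup.primaryComponent A p) = p ^ k := by
  have hpgroup : IsPGroup p (Multiplicative (AddCommGroup.primaryComponent A p)) := by
    rintro ⟨x, k, hk⟩
    exact ⟨k, Subtype.ext hk⟩
  obtain ⟨k, hk⟩ := IsPGroup.iff_card.1 hpgroup
  exact ⟨k, hk⟩

variable {A}

theorem card_torsion'_eq_of_injective (hS : 0 ∉ S) {j : A →ₗ[ℤ] B} (hj : Function.Injective j)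
    (hrange : (AddCommGroup.torsion B : Set B) ⊆ Set.range j) :
    Nat.card (torsion' ℤ A S) = Nat.card (torsion' ℤ B S) := by
  refine Nat.card_congr <| Equiv.ofBijective
    (fun x => ⟨j x, map_mem_torsion' j x.2⟩) ⟨fun x y hxy => ?_, ?_⟩
  · exact Subtype.ext (hj (Subtype.mk.inj hxy))
  · rintro ⟨y, hy⟩
    obtain ⟨x, rfl⟩ := hrange (torsion'_le_torsion B hS hy)
    obtain ⟨m, hm, hmx⟩ := mem_torsion'_submonoid_iff.1 hy
    exact ⟨⟨x, mem_torsion'_submonoid_iff.2 ⟨m, hm, hj (by rw [map_nsmul, hmx, map_zero])⟩⟩, rfl⟩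

end Torsion

/-! ### Prime-to-`p` torsion of coinvariants -/

section Coinvariants

variable {p n : ℕ}

theorem bijective_of_iterate_eq_id {α : Type*} {f : α → α} {k : ℕ} (hk : k ≠ 0)
    (hf : f^[k] = id) : f.Bijective := by
  obtain ⟨k, rfl⟩ := Nat.exists_eq_succ_of_ne_zero hk
  exact ⟨Function.LeftInverse.injective (congrFun (Function.iterate_succ f k ▸ hf)),
    Function.RightInverse.surjective (congrFun (Function.iterate_succ' f k ▸ hf))⟩

theorem pow_succ_dvd_card_of_iterate_ne [Fact p.Prime] {α : Type*} [Finite α] {f : α → α}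
    (hf : f^[p ^ (n + 1)] = id) (hfree : ∀ x, f^[p ^ n] x ≠ x) : p ^ (n + 1) ∣ Nat.card α := by
  classical
  cases nonempty_fintype α
  let σ : Equiv.Perm α :=
    Equiv.ofBijective f (bijective_of_iterate_eq_id (NeZero.ne (p ^ (n + 1))) hf)
  have horbit (x : α) : Nat.card (MulAction.orbit (Subgroup.zpowers σ) x) = p ^ (n + 1) := by
    rw [Nat.card_eq_fintype_card, ← MulAction.minimalPeriod_eq_card]
    exact Function.minimalPeriod_eq_prime_pow (hfree x) (congrFun hf x)
  rw [Nat.card_congr (MulAction.selfEquivSigmaOrbits (Subgroup.zpowers σ) α), Nat.card_sigma]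
  exact Finset.dvd_sum fun x _ => by rw [horbit]

theorem card_modEq_card_isFixedPt_iterate [Fact p.Prime] {α : Type*} [Finite α] {f : α → α}
    (hf : f^[p ^ (n + 1)] = id) :
    Nat.card α ≡ Nat.card {x // f^[p ^ n] x = x} [MOD p ^ (n + 1)] := by
  classical
  have hinj : f.Injective := (bijective_of_iterate_eq_id (NeZero.ne (p ^ (n + 1))) hf).injective
  have hmaps : Set.MapsTo f {x | f^[p ^ n] x ≠ x} {x | f^[p ^ n] x ≠ x} := fun x hx h =>
    hx (hinj ((Function.Commute.self_iterate f _ x).trans h))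
  have hdvd : p ^ (n + 1) ∣ Nat.card {x // f^[p ^ n] x ≠ x} := by
    refine pow_succ_dvd_card_of_iterate_ne (f := hmaps.restrict) ?_ fun x hx => ?_
    · funext x
      exact Subtype.ext ((hmaps.coe_iterate_restrict x _).trans (congrFun hf x))
    · exact x.2 ((hmaps.coe_iterate_restrict x _).symm.trans (congrArg Subtype.val hx))
  rw [← Nat.card_congr (Equiv.sumCompl fun x => f^[p ^ n] x = x), Nat.card_sum]
  exact Nat.ModEq.add_left _ (Nat.modEq_zero_iff_dvd.2 hdvd)

theorem mul_geom_sum_self {R : Type*} [Ring R] {s : R} (hs : s ^ n = 1) :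
    s * ∑ i ∈ Finset.range n, s ^ i = ∑ i ∈ Finset.range n, s ^ i := by
  rw [← sub_eq_zero, ← sub_one_mul, mul_geom_sum, hs, sub_self]

variable {M M' : Type*} [AddCommGroup M] [AddCommGroup M'] {s : Module.End ℤ M} {π : M →ₗ[ℤ] M'}

theorem geom_sum_apply (s : Module.End ℤ M) (n : ℕ) (x : M) :
    (∑ i ∈ Finset.range n, s ^ i) x = ∑ i ∈ Finset.range n, s^[i] x := by
  simp_rw [← Module.End.coe_pow]
  exact LinearMap.sum_apply _ _ _

theorem geom_sum_apply_of_fixed {x : M} (hx : s x = x) (n : ℕ) :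
    (∑ i ∈ Finset.range n, s ^ i) x = n • x := by
  simp_rw [geom_sum_apply, Function.iterate_fixed hx, Finset.sum_const, Finset.card_range]

theorem map_geom_sum_apply (hπs : ∀ x, π (s x) = π x) (n : ℕ) (x : M) :
    π ((∑ i ∈ Finset.range n, s ^ i) x) = n • π x := by
  have hiter (i : ℕ) : π (s^[i] x) = π x := by
    simpa using (Function.Semiconj.iterate_right (f := π) (gb := id) hπs i) x
  simp_rw [geom_sum_apply, map_sum, hiter, Finset.sum_const, Finset.card_range]

variable {S : Submonoid ℕ}

open Submodule

theorem map_apply_of_exact (hexact : Function.Exact (s - 1 : Module.End ℤ M) π) (x : M) :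
    π (s x) = π x := by
  rw [← sub_eq_zero, ← map_sub, hexact]
  exact ⟨x, rfl⟩

theorem geom_sum_eq_zero_of_exact (hs : s ^ p = 1)
    (hexact : Function.Exact (s - 1 : Module.End ℤ M) π) {x : M} (hx : π x = 0) :
    (∑ i ∈ Finset.range p, s ^ i) x = 0 := by
  obtain ⟨y, rfl⟩ := (hexact x).1 hx
  refine (DFunLike.congr_fun (geom_sum_mul s p) y).trans ?_
  rw [hs, sub_self]
  rfl

theorem eq_zero_of_map_eq_zero_of_fixed (hs : s ^ p = 1)
    (hexact : Function.Exact (s - 1 : Module.End ℤ M) π) (hS : S ≤ coprimeSubmonoid p) {x : M}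
    (hx : x ∈ torsion' ℤ M S) (hsx : s x = x) (hπx : π x = 0) : x = 0 := by
  obtain ⟨m, hm, hmx⟩ := mem_torsion'_submonoid_iff.1 hx
  have hpx : p • x = 0 := by
    rw [← geom_sum_apply_of_fixed hsx, geom_sum_eq_zero_of_exact hs hexact hπx]
  exact AddMonoid.addOrderOf_eq_one_iff.1 <| Nat.eq_one_of_dvd_coprimes (hS hm)
    (addOrderOf_dvd_of_nsmul_eq_zero hmx) (addOrderOf_dvd_of_nsmul_eq_zero hpx)

/- With `N = 1 + s + ⋯ + s ^ (p - 1)` and `a * p ≡ 1` modulo the order of `π x`, the element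
`a • N x` is a fixed torsion preimage of `π x`. -/
theorem exists_fixed_torsion'_map_eq (hs : s ^ p = 1) (hπ : Function.Surjective π)
    (hexact : Function.Exact (s - 1 : Module.End ℤ M) π) (hS : S ≤ coprimeSubmonoid p) {x' : M'}
    (hx' : x' ∈ torsion' ℤ M' S) : ∃ x ∈ torsion' ℤ M S, s x = x ∧ π x = x' := by
  obtain ⟨m, hm, hmx'⟩ := mem_torsion'_submonoid_iff.1 hx'
  obtain ⟨x, rfl⟩ := hπ x'
  obtain ⟨b, a, hab⟩ : IsCoprime (m : ℤ) p := Nat.isCoprime_iff_coprime.2 (hS hm)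
  refine ⟨a • (∑ i ∈ Finset.range p, s ^ i) x, mem_torsion'_submonoid_iff.2 ⟨m, hm, ?_⟩, ?_, ?_⟩
  · rw [smul_comm, ← map_nsmul, geom_sum_eq_zero_of_exact hs hexact (by rw [map_nsmul, hmx']),
      smul_zero]
  · rw [map_zsmul]
    exact congrArg (a • ·) (DFunLike.congr_fun (mul_geom_sum_self hs) x)
  · rw [map_zsmul, map_geom_sum_apply (map_apply_of_exact hexact)]
    calc a • p • π x = (b * m + a * p) • π x := by
          rw [add_smul, mul_smul, mul_smul, natCast_zsmul, natCast_zsmul, hmx', smul_zero, zero_add]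
      _ = π x := by rw [hab, one_smul]

theorem card_fixed_torsion'_eq (hs : s ^ p = 1) (hπ : Function.Surjective π)
    (hexact : Function.Exact (s - 1 : Module.End ℤ M) π) (hS : S ≤ coprimeSubmonoid p) :
    Nat.card {x : torsion' ℤ M S // s x = x} = Nat.card (torsion' ℤ M' S) := by
  refine Nat.card_congr <| Equiv.ofBijective
    (fun x => ⟨π x, map_mem_torsion' π x.1.2⟩) ⟨fun x y hxy => ?_, ?_⟩
  · have hsub : (x : M) - y = 0 := eq_zero_of_map_eq_zero_of_fixed hs hexact hS
      (sub_mem x.1.2 y.1.2) (by rw [map_sub, x.2, y.2])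
      (by rw [map_sub, Subtype.mk.inj hxy, sub_self])
    exact Subtype.ext (Subtype.ext (sub_eq_zero.1 hsub))
  · rintro ⟨x', hx'⟩
    obtain ⟨x, hx, hsx, rfl⟩ := exists_fixed_torsion'_map_eq hs hπ hexact hS hx'
    exact ⟨⟨⟨x, hx⟩, hsx⟩, rfl⟩

theorem card_torsion'_modEq [Fact p.Prime] {t : Module.End ℤ M} (ht : t ^ p ^ (n + 1) = 1)
    (hπ : Function.Surjective π) (hexact : Function.Exact (t ^ p ^ n - 1 : Module.End ℤ M) π)
    (hS : S ≤ coprimeSubmonoid p) [Finite (torsion' ℤ M S)] :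
    Nat.card (torsion' ℤ M S) ≡ Nat.card (torsion' ℤ M' S) [MOD p ^ (n + 1)] := by
  have hs : (t ^ p ^ n) ^ p = 1 := by rw [← pow_mul, ← pow_succ, ht]
  let f (x : torsion' ℤ M S) : torsion' ℤ M S := ⟨t x, map_mem_torsion' t x.2⟩
  have hf (k : ℕ) (x : torsion' ℤ M S) : (f^[k] x : M) = (t ^ k) x := by
    rw [Module.End.coe_pow]
    exact Function.Semiconj.iterate_right (f := Subtype.val) (fun _ => rfl) k x
  have hperiod : f^[p ^ (n + 1)] = id := funext fun x => Subtype.ext (by rw [hf, ht]; rfl)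
  have hfixed (x : torsion' ℤ M S) : f^[p ^ n] x = x ↔ (t ^ p ^ n) x = x := by
    rw [Subtype.ext_iff, hf]
  rw [← card_fixed_torsion'_eq hs hπ hexact hS, ← Nat.card_congr (Equiv.subtypeEquivRight hfixed)]
  exact card_modEq_card_isFixedPt_iterate hperiod

end Coinvariants

/-! ### Convergence of sequences of natural numbers in `ℤ_[p]` -/

section PadicConvergence

variable {p : ℕ} [Fact p.Prime]

theorem tendsto_padicInt_of_modEq {a : ℕ → ℕ} (h : ∀ n, a (n + 1) ≡ a n [MOD p ^ (n + 1)]) :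
    ∃ x : ℤ_[p], Tendsto (fun n => (a n : ℤ_[p])) atTop (𝓝 x) := by
  have hp : 1 < (p : ℝ) := by exact_mod_cast (Fact.out : p.Prime).one_lt
  refine cauchySeq_tendsto_of_complete (cauchySeq_of_le_geometric (p : ℝ)⁻¹ 1
    (inv_lt_one_of_one_lt₀ hp) fun n => ?_)
  have hdvd : ((p ^ n : ℕ) : ℤ) ∣ (a n : ℤ) - a (n + 1) :=
    (Int.natCast_dvd_natCast.2 (pow_dvd_pow p n.le_succ)).trans (Nat.modEq_iff_dvd.1 (h n))
  have hnorm : ‖(((a n : ℤ) - a (n + 1) : ℤ) : ℤ_[p])‖ ≤ (p : ℝ) ^ (-n : ℤ) := by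
    rw [PadicInt.norm_int_le_pow_iff_dvd]
    exact_mod_cast hdvd
  rw [dist_eq_norm]
  push_cast at hnorm
  simpa using hnorm

theorem tendsto_padicInt_pow_of_monotone {e : ℕ → ℕ} (he : Monotone e) :
    ∃ x : ℤ_[p], Tendsto (fun n => (p : ℤ_[p]) ^ e n) atTop (𝓝 x) := by
  rcases tendsto_atTop_of_monotone he with htop | ⟨k, hk⟩
  · have hzero : Tendsto (fun k : ℕ => (p : ℤ_[p]) ^ k) atTop (𝓝 0) :=
      tendsto_pow_atTop_nhds_zero_of_norm_lt_one Padic.norm_p_lt_one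
    exact ⟨0, hzero.comp htop⟩
  · exact ⟨(p : ℤ_[p]) ^ k, (continuous_of_discreteTopology.tendsto k).comp hk⟩

theorem tendsto_padicInt_of_eventually_le {a : ℕ → ℕ} (hpow : ∀ n, ∃ k, a n = p ^ k)
    (hle : ∀ᶠ n in atTop, a n ≤ a (n + 1)) :
    ∃ x : ℤ_[p], Tendsto (fun n => (a n : ℤ_[p])) atTop (𝓝 x) := by
  choose e he using hpow
  obtain ⟨N, hN⟩ := eventually_atTop.1 hle
  have hmono : Monotone fun n => e (n + N) := monotone_nat_of_le_succ fun n => by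
    have := hN (n + N) (by omega)
    rwa [he, he, Nat.pow_le_pow_iff_right (Fact.out : p.Prime).one_lt, add_right_comm] at this
  obtain ⟨x, hx⟩ := tendsto_padicInt_pow_of_monotone (p := p) hmono
  refine ⟨x, (tendsto_add_atTop_iff_nat N).1 ?_⟩
  simpa only [he, Nat.cast_pow] using hx

end PadicConvergence

/-! ### Layers of a Noetherian module -/

theorem card_primaryComponent_eq_card_ker_mul {G H : Type*} [AddCommGroup G] [AddCommGroup H]
    {p j : ℕ} {q : G →+ H} (hq : Function.Surjective q) (hj : ∀ x ∈ q.ker, p ^ j • x = 0) :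
    Nat.card (AddCommGroup.primaryComponent G p) =
      Nat.card q.ker * Nat.card (AddCommGroup.primaryComponent H p) := by
  have hcomap : AddCommGroup.primaryComponent G p =
      (AddCommGroup.primaryComponent H p).comap q := by
    ext x
    constructor
    · rintro ⟨k, hk⟩
      exact ⟨k, by rw [← map_nsmul, hk, map_zero]⟩
    · rintro ⟨k, hk⟩
      refine ⟨j + k, ?_⟩
      rw [pow_add, mul_smul]
      exact hj _ (by rw [AddMonoidHom.mem_ker, map_nsmul, hk])
  have hker : q.ker ≤ AddCommGroup.primaryComponent G p := fun x hx => ⟨j, hj x hx⟩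
  rw [← AddSubgroup.relIndex_bot_left, ← AddSubgroup.relIndex_mul_relIndex _ _ _ bot_le hker,
    AddSubgroup.relIndex_bot_left, AddSubgroup.relIndex_ker, hcomap,
    AddSubgroup.map_comap_eq_self_of_surjective hq]

section NoetherianLayers

open Submodule
open scoped Pointwise

variable {Λ E : Type*} [CommRing Λ] [AddCommGroup E] [Module Λ E] {p : ℕ}

theorem finite_torsionBySet_of_finite_quotient [IsNoetherian Λ E] (I : Ideal Λ) [Finite (Λ ⧸ I)] :
    Finite (torsionBySet Λ E I) := by
  have : Module.Finite (Λ ⧸ I) (torsionBySet Λ E I) :=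
    Module.Finite.of_restrictScalars_finite Λ (Λ ⧸ I) _
  exact Module.finite_of_finite (Λ ⧸ I)

theorem finite_comap_mkQ (F : Submodule Λ E) [Finite F] (N : Submodule Λ (E ⧸ F)) [Finite N] :
    Finite (N.comap F.mkQ) := by
  have hpre : (F.mkQ ⁻¹' N).Finite := by
    refine Set.Finite.preimage' (Set.toFinite _) fun b _ => ?_
    obtain ⟨a, rfl⟩ := F.mkQ_surjective b
    refine ((Set.toFinite (F : Set E)).image (a + ·)).subset fun x hx => ?_
    exact ⟨x - a, (Submodule.Quotient.eq _).1 hx, add_sub_cancel _ _⟩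
  exact hpre

variable (Λ E p) in
theorem exists_maximal_finite_pow_torsion [IsNoetherian Λ E] :
    ∃ F : Submodule Λ E, Finite F ∧ (∃ j : ℕ, ∀ x ∈ F, p ^ j • x = 0) ∧
      ∀ N : Submodule Λ (E ⧸ F), Finite N → (∀ x ∈ N, p • x = 0) → N = ⊥ := by
  obtain ⟨F, ⟨hF, j, hj⟩, hmax⟩ := set_has_maximal_iff_noetherian.2 ‹IsNoetherian Λ E›
    {N | Finite N ∧ ∃ j : ℕ, ∀ x ∈ N, p ^ j • x = 0}
    ⟨⊥, inferInstance, 0, by rintro x hx; rw [(mem_bot Λ).1 hx, smul_zero]⟩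
  refine ⟨F, hF, ⟨j, hj⟩, fun N _ hpN => ?_⟩
  have hpow : ∀ x ∈ N.comap F.mkQ, p ^ (j + 1) • x = 0 := fun x hx => by
    rw [pow_succ, mul_smul]
    refine hj _ ?_
    rw [← Quotient.mk_eq_zero, Quotient.mk_smul]
    exact hpN _ hx
  have hcomap : F = N.comap F.mkQ :=
    (le_comap_mkQ F N).eq_of_not_lt (hmax _ ⟨finite_comap_mkQ F N, j + 1, hpow⟩)
  rw [← map_comap_eq_of_surjective F.mkQ_surjective N, ← hcomap, mkQ_map_self]

theorem eventually_disjoint_of_iInf_eq_bot (F : Submodule Λ E) [Finite F] {V : ℕ → Submodule Λ E}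
    (hV : Antitone V) (hbot : ⨅ n, V n = ⊥) : ∀ᶠ n in atTop, Disjoint F (V n) := by
  have hpoint : ∀ x : F, ∀ᶠ n in atTop, (x : E) ∈ V n → (x : E) = 0 := by
    intro x
    by_cases hx : ∀ n, (x : E) ∈ V n
    · have : (x : E) ∈ ⨅ n, V n := (mem_iInf V).2 hx
      rw [hbot, Submodule.mem_bot] at this
      exact .of_forall fun _ _ => this
    · obtain ⟨m, hm⟩ := not_forall.1 hx
      filter_upwards [eventually_ge_atTop m] with n hn hxn using absurd (hV hn hxn) hm
  filter_upwards [eventually_all.2 hpoint] with n hn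
  exact disjoint_def.2 fun x hxF hxV => hn ⟨x, hxF⟩ hxV

theorem card_primaryComponent_quotSMulTop {F : Submodule Λ E} {j : ℕ}
    (hj : ∀ x ∈ F, p ^ j • x = 0) {a : Λ} (hdisj : Disjoint F (a • ⊤)) :
    Nat.card (AddCommGroup.primaryComponent (QuotSMulTop a E) p) =
      Nat.card F * Nat.card (AddCommGroup.primaryComponent (QuotSMulTop a (E ⧸ F)) p) := by
  let q := QuotSMulTop.map a F.mkQ
  let i : F →ₗ[Λ] QuotSMulTop a E := (a • ⊤ : Submodule Λ E).mkQ ∘ₗ F.subtype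
  have hi : Function.Injective i := by
    rwa [← LinearMap.ker_eq_bot, LinearMap.ker_comp, ker_mkQ, ← disjoint_iff_comap_eq_bot]
  have hrange : LinearMap.range i = LinearMap.ker q := by
    have hexact := QuotSMulTop.map_exact a (LinearMap.exact_subtype_mkQ F) F.mkQ_surjective
    rw [hexact.linearMap_ker_eq, ← LinearMap.range_comp_of_range_eq_top
      (QuotSMulTop.map a F.subtype) (range_mkQ (a • ⊤)), QuotSMulTop.map_comp_mkQ]
  have hker : ∀ x ∈ q.toAddMonoidHom.ker, p ^ j • x = 0 := by
    intro x hx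
    obtain ⟨y, rfl⟩ : x ∈ LinearMap.range i := hrange ▸ LinearMap.mem_ker.2 hx
    rw [← map_nsmul, show p ^ j • y = 0 from Subtype.ext (hj y y.2), map_zero]
  have hcard : Nat.card q.toAddMonoidHom.ker = Nat.card F :=
    Nat.card_congr ((LinearEquiv.ofInjective i hi).trans (LinearEquiv.ofEq _ _ hrange)).symm.toEquiv
  rw [← hcard]
  exact card_primaryComponent_eq_card_ker_mul
    (QuotSMulTop.map_surjective a F.mkQ_surjective) hker

theorem card_primaryComponent_quotSMulTop_le (a b : Λ) (hb : torsionBy Λ E b = ⊥)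
    [Finite (AddCommGroup.primaryComponent (QuotSMulTop (a * b) E) p)] :
    Nat.card (AddCommGroup.primaryComponent (QuotSMulTop a E) p) ≤
      Nat.card (AddCommGroup.primaryComponent (QuotSMulTop (a * b) E) p) := by
  have hle : a • ⊤ ≤ ((a * b) • ⊤ : Submodule Λ E).comap (LinearMap.lsmul Λ E b) := by
    rintro _ ⟨y, -, rfl⟩
    exact ⟨y, trivial, by simp [mul_smul, smul_comm a b]⟩
  let f : QuotSMulTop a E →ₗ[Λ] QuotSMulTop (a * b) E := mapQ _ _ (LinearMap.lsmul Λ E b) hle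
  have hf : Function.Injective f := by
    refine (injective_iff_map_eq_zero f).2 fun z hz => ?_
    obtain ⟨x, rfl⟩ := mkQ_surjective _ z
    obtain ⟨y, -, hy⟩ := (Quotient.mk_eq_zero _).1 hz
    have hy' : b • (a • y - x) = 0 := by
      rw [smul_sub, ← mul_smul, mul_comm]
      exact sub_eq_zero.2 hy
    rw [← mem_torsionBy_iff, hb, Submodule.mem_bot, sub_eq_zero] at hy'
    exact (Quotient.mk_eq_zero _).2 ⟨y, trivial, hy'⟩
  refine Nat.card_le_card_of_injective (fun z => ⟨f z, ?_⟩)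
    fun z w hzw => Subtype.ext (hf (congrArg Subtype.val hzw))
  obtain ⟨k, hk⟩ := z.2
  exact ⟨k, by rw [← map_nsmul, hk, map_zero]⟩

variable {ω ν : ℕ → Λ}

theorem antitone_smul_top (hω : ∀ n, ω (n + 1) = ω n * ν n) :
    Antitone fun n => ω n • (⊤ : Submodule Λ E) := by
  refine antitone_nat_of_succ_le fun n => ?_
  rintro _ ⟨y, -, rfl⟩
  exact ⟨ν n • y, trivial, by simp [hω, mul_smul, smul_comm (ω n)]⟩

variable [IsNoetherian Λ E]

-- The chain of kernels of `ω n` stabilizes, and on a common kernel `ν n` acts as `p`.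
theorem exists_torsionBy_le_torsionBySet (hω : ∀ n, ω (n + 1) = ω n * ν n)
    (hν : ∀ n, ω n ∣ ν n - p) :
    ∃ k, ∀ n ≥ k, torsionBy Λ E (ν n) ≤ torsionBySet Λ E {ω k, (p : Λ)} := by
  have hmono : Monotone fun n => torsionBy Λ E (ω n) :=
    monotone_nat_of_le_succ fun n => torsionBy_le_torsionBy_of_dvd _ _ ⟨ν n, hω n⟩
  obtain ⟨k, hk⟩ := monotone_stabilizes_iff_noetherian.2 ‹_› ⟨_, hmono⟩
  replace hk : ∀ n ≥ k, torsionBy Λ E (ω n) = torsionBy Λ E (ω k) := fun n hn => (hk n hn).symm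
  refine ⟨k, fun n hn x hx => ?_⟩
  have hxk : x ∈ torsionBy Λ E (ω k) := by
    rw [← hk (n + 1) (by omega)]
    exact torsionBy_le_torsionBy_of_dvd _ _ ⟨ω n, by rw [hω, mul_comm]⟩ hx
  have hxp : (p : Λ) • x = 0 := by
    obtain ⟨c, hc⟩ := hν n
    have hxn : x ∈ torsionBy Λ E (ω n) := hk n hn ▸ hxk
    rw [mem_torsionBy_iff] at hx hxn
    rw [← sub_sub_cancel (ν n) (p : Λ), hc, sub_smul, hx, mul_comm, mul_smul, hxn, smul_zero,
      sub_zero]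
  rw [mem_torsionBySet_iff]
  rintro ⟨_, rfl | rfl⟩
  exacts [hxk, hxp]

theorem eventually_torsionBy_eq_bot (hω : ∀ n, ω (n + 1) = ω n * ν n) (hν : ∀ n, ω n ∣ ν n - p)
    (hfin : ∀ n, Finite (Λ ⧸ Ideal.span {ω n, (p : Λ)}))
    (hE : ∀ N : Submodule Λ E, Finite N → (∀ x ∈ N, p • x = 0) → N = ⊥) :
    ∀ᶠ n in atTop, torsionBy Λ E (ν n) = ⊥ := by
  obtain ⟨k, hk⟩ := exists_torsionBy_le_torsionBySet (E := E) hω hν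
  have := hfin k
  have hbot : torsionBySet Λ E {ω k, (p : Λ)} = ⊥ := by
    rw [torsionBySet_eq_torsionBySet_span]
    refine hE _ (finite_torsionBySet_of_finite_quotient _) fun x hx => ?_
    rw [← Nat.cast_smul_eq_nsmul Λ]
    exact (mem_torsionBySet_iff _ _).1 hx ⟨(p : Λ), Ideal.subset_span (by simp)⟩
  filter_upwards [eventually_ge_atTop k] with n hn
  exact eq_bot_iff.2 (hbot ▸ hk n hn)

theorem eventually_card_primaryComponent_le (hω : ∀ n, ω (n + 1) = ω n * ν n)
    (hν : ∀ n, ω n ∣ ν n - p) (hfin : ∀ n, Finite (Λ ⧸ Ideal.span {ω n, (p : Λ)}))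
    (hsep : ⨅ n, ω n • (⊤ : Submodule Λ E) = ⊥)
    (hT : ∀ n, Finite (AddCommGroup.primaryComponent (QuotSMulTop (ω n) E) p)) :
    ∀ᶠ n in atTop, Nat.card (AddCommGroup.primaryComponent (QuotSMulTop (ω n) E) p) ≤
      Nat.card (AddCommGroup.primaryComponent (QuotSMulTop (ω (n + 1)) E) p) := by
  obtain ⟨F, _, ⟨j, hj⟩, hmax⟩ := exists_maximal_finite_pow_torsion Λ E p
  have hdisj := eventually_disjoint_of_iInf_eq_bot F (antitone_smul_top hω) hsep
  filter_upwards [hdisj, tendsto_add_atTop_nat 1 |>.eventually hdisj,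
    eventually_torsionBy_eq_bot hω hν hfin hmax] with n hn hn' hinj
  have hcard := card_primaryComponent_quotSMulTop (p := p) hj hn'
  have : Finite (AddCommGroup.primaryComponent (QuotSMulTop (ω (n + 1)) (E ⧸ F)) p) :=
    Nat.finite_of_card_ne_zero fun h => Nat.card_pos.ne' (hcard.trans (by rw [h, mul_zero]))
  rw [card_primaryComponent_quotSMulTop hj hn, hcard]
  rw [hω n] at this ⊢
  exact Nat.mul_le_mul_left _ (card_primaryComponent_quotSMulTop_le _ _ hinj)

end NoetherianLayers

/-! ### Inverse limits of layers -/

section LayerTower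

open Submodule
open scoped Pointwise

variable {Λ : Type*} [CommRing Λ]

theorem eq_top_of_map_eq_top {M N : Type*} [AddCommGroup M] [AddCommGroup N] [Module Λ M]
    [Module Λ N] [Module.Finite Λ M] {a : Λ} (ha : a ∈ Ideal.jacobson (⊥ : Ideal Λ))
    {f : M →ₗ[Λ] N} (hf : LinearMap.ker f ≤ a • ⊤) {L : Submodule Λ M} (hL : L.map f = ⊤) :
    L = ⊤ := by
  refine top_le_iff.1 (le_of_le_smul_of_le_jacobson_bot (I := Ideal.span {a})
    Module.Finite.fg_top ((Ideal.span_singleton_le_iff_mem _).2 ha) ?_)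
  rw [ideal_span_singleton_smul]
  calc ⊤ = L ⊔ LinearMap.ker f := by rw [← comap_map_eq, hL, Submodule.comap_top]
    _ ≤ L ⊔ a • ⊤ := sup_le_sup_left hf L

theorem iInf_sup_smul_top_le_of_compactSpace {M : Type*} [AddCommGroup M] [Module Λ M]
    [TopologicalSpace M] [IsTopologicalAddGroup M] [ContinuousConstSMul Λ M] [CompactSpace M]
    {V : ℕ → Submodule Λ M} (hV : Antitone V) (hclosed : ∀ n, IsClosed (V n : Set M)) (a : Λ) :
    ⨅ n, (V n ⊔ a • ⊤) ≤ (⨅ n, V n) ⊔ a • ⊤ := by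
  intro x hx
  let S : ℕ → Set M := fun n => (fun y => x - a • y) ⁻¹' V n
  have hS : ∀ n, IsClosed (S n) := fun n => (hclosed n).preimage (by fun_prop)
  have hne : ∀ n, (S n).Nonempty := fun n => by
    obtain ⟨v, hv, _, ⟨y, -, rfl⟩, rfl⟩ := mem_sup.1 ((mem_iInf _).1 hx n)
    exact ⟨y, by simpa [S] using hv⟩
  obtain ⟨y, hy⟩ := IsCompact.nonempty_iInter_of_sequence_nonempty_isCompact_isClosed S
    (fun n _ hz => hV n.le_succ hz) hne (hS 0).isCompact hS
  rw [← sub_add_cancel x (a • y)]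
  exact add_mem_sup ((mem_iInf V).2 fun n => Set.mem_iInter.1 hy n)
    (smul_mem_pointwise_smul y a ⊤ trivial)

variable {ω : ℕ → Λ} {E : ℕ → Type*} [∀ n, AddCommGroup (E n)] [∀ n, Module Λ (E n)]
  {π : ∀ n, E (n + 1) →ₗ[Λ] E n}

/-- A tower of modules in which the `n`-th one is the reduction modulo `ω n` of the next one; this
is how the layers `E ⧸ ω n • E` of a single module `E` fit together when `ω n ∣ ω (n + 1)`. -/
structure IsLayerTower (ω : ℕ → Λ) (π : ∀ n, E (n + 1) →ₗ[Λ] E n) : Prop where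
  surjective : ∀ n, Function.Surjective (π n)
  smul_eq_zero : ∀ n (x : E n), ω n • x = 0
  ker_le : ∀ n, LinearMap.ker (π n) ≤ ω n • ⊤

namespace IsLayerTower

theorem exists_surjective_lifts (h : IsLayerTower ω π) (hω : ∀ n, ω 0 ∣ ω n)
    (hjac : ω 0 ∈ Ideal.jacobson (⊥ : Ideal Λ)) [∀ n, Module.Finite Λ (E n)] :
    ∃ (d : ℕ) (φ : ∀ n, (Fin d → Λ) →ₗ[Λ] E n),
      (∀ n, π n ∘ₗ φ (n + 1) = φ n) ∧ ∀ n, Function.Surjective (φ n) := by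
  obtain ⟨d, x₀, hx₀⟩ := fg_iff_exists_fin_generating_family.1
    (Module.Finite.fg_top : (⊤ : Submodule Λ (E 0)).FG)
  let x : ∀ n, Fin d → E n :=
    fun n => Nat.rec x₀ (fun n y i => Function.surjInv (h.surjective n) (y i)) n
  have hx : ∀ n i, π n (x (n + 1) i) = x n i := fun n i => Function.surjInv_eq (h.surjective n) _
  let φ : ∀ n, (Fin d → Λ) →ₗ[Λ] E n := fun n => Fintype.linearCombination Λ (x n)
  have hφ : ∀ n, π n ∘ₗ φ (n + 1) = φ n := fun n => LinearMap.ext fun f => by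
    simp only [φ, LinearMap.comp_apply, Fintype.linearCombination_apply, map_sum, map_smul, hx]
  have hker : ∀ n, LinearMap.ker (π n) ≤ ω 0 • ⊤ := fun n => (h.ker_le n).trans (by
    obtain ⟨c, hc⟩ := hω n
    rw [hc, mul_smul]
    exact smul_mono_right _ le_top)
  refine ⟨d, φ, hφ, fun n => LinearMap.range_eq_top.1 ?_⟩
  induction n with
  | zero => exact (Fintype.range_linearCombination Λ x₀).trans hx₀
  | succ n ih =>
    exact eq_top_of_map_eq_top hjac (hker n) (by rw [← LinearMap.range_comp, hφ, ih])

variable {M : Type*} [AddCommGroup M] [Module Λ M] {φ : ∀ n, M →ₗ[Λ] E n}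

theorem ker_le_ker_sup_smul_top (h : IsLayerTower ω π) (hω : ∀ n, ω n ∣ ω (n + 1))
    (hφ : ∀ n, π n ∘ₗ φ (n + 1) = φ n) (hsurj : ∀ n, Function.Surjective (φ n))
    {m n : ℕ} (hmn : m ≤ n) : LinearMap.ker (φ m) ≤ LinearMap.ker (φ n) ⊔ ω m • ⊤ := by
  induction n, hmn using Nat.le_induction with
  | base => exact le_sup_left
  | succ n hmn ih =>
    obtain ⟨c, hc⟩ := Nat.rel_of_forall_rel_succ_of_le (· ∣ ·) hω hmn
    refine ih.trans (sup_le (fun x hx => ?_) le_sup_right)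
    obtain ⟨e, -, he⟩ := h.ker_le n (x := φ (n + 1) x) (by
      rw [LinearMap.mem_ker, ← LinearMap.comp_apply, hφ]
      exact hx)
    obtain ⟨y, rfl⟩ := hsurj (n + 1) e
    rw [← sub_add_cancel x (ω n • y)]
    refine add_mem_sup ?_ ⟨c • y, trivial, by simp [hc, mul_smul, smul_comm c]⟩
    rw [LinearMap.mem_ker, map_sub, map_smul]
    exact sub_eq_zero.2 he.symm

variable [TopologicalSpace M] [IsTopologicalAddGroup M] [ContinuousConstSMul Λ M] [CompactSpace M]

theorem ker_eq_iInf_sup_smul_top (h : IsLayerTower ω π) (hω : ∀ n, ω n ∣ ω (n + 1))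
    (hφ : ∀ n, π n ∘ₗ φ (n + 1) = φ n) (hsurj : ∀ n, Function.Surjective (φ n))
    (hclosed : ∀ n, IsClosed (LinearMap.ker (φ n) : Set M)) (n : ℕ) :
    LinearMap.ker (φ n) = (⨅ m, LinearMap.ker (φ m)) ⊔ ω n • ⊤ := by
  have hanti : Antitone fun m => LinearMap.ker (φ m) := antitone_nat_of_succ_le fun m => by
    rw [← hφ m]
    exact LinearMap.ker_le_ker_comp _ _
  refine le_antisymm ?_ (sup_le (iInf_le _ n) ?_)
  · refine le_trans (le_iInf fun m => ?_) (iInf_sup_smul_top_le_of_compactSpace hanti hclosed _)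
    exact (h.ker_le_ker_sup_smul_top hω hφ hsurj (le_max_left n m)).trans
      (sup_le_sup_right (hanti (le_max_right n m)) _)
  · rintro _ ⟨y, -, rfl⟩
    rw [LinearMap.mem_ker]
    exact (map_smul (φ n) _ y).trans (h.smul_eq_zero n _)

-- `K` consists of the relations between compatible lifts of generators of the bottom layer, so
-- that `Λ ^ d ⧸ K` is the inverse limit of the tower.
theorem exists_quotSMulTop_equiv [IsNoetherianRing Λ] [TopologicalSpace Λ] [IsTopologicalRing Λ]
    [CompactSpace Λ] [T2Space Λ] [∀ n, Module.Finite Λ (E n)] (h : IsLayerTower ω π)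
    (hω : ∀ n, ω n ∣ ω (n + 1)) (hjac : ω 0 ∈ Ideal.jacobson (⊥ : Ideal Λ)) :
    ∃ (d : ℕ) (K : Submodule Λ (Fin d → Λ)),
      ⨅ n, ω n • (⊤ : Submodule Λ ((Fin d → Λ) ⧸ K)) = ⊥ ∧
      ∀ n, Nonempty (QuotSMulTop (ω n) ((Fin d → Λ) ⧸ K) ≃ₗ[Λ] E n) := by
  obtain ⟨d, φ, hφ, hsurj⟩ := h.exists_surjective_lifts
    (fun n => Nat.rel_of_forall_rel_succ_of_le (· ∣ ·) hω n.zero_le) hjac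
  have hclosed : ∀ n, IsClosed (LinearMap.ker (φ n) : Set (Fin d → Λ)) := fun n =>
    (isCompact_of_fg (IsNoetherian.noetherian _)).isClosed
  let K := ⨅ n, LinearMap.ker (φ n)
  let ψ : ∀ n, ((Fin d → Λ) ⧸ K) →ₗ[Λ] E n := fun n => K.liftQ (φ n) (iInf_le _ n)
  have hker : ∀ n, LinearMap.ker (ψ n) = ω n • ⊤ := fun n => by
    rw [ker_liftQ, h.ker_eq_iInf_sup_smul_top hω hφ hsurj hclosed, Submodule.map_sup, mkQ_map_self,
      bot_sup_eq, map_pointwise_smul, Submodule.map_top, range_mkQ]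
  have hψ : ∀ n, Function.Surjective (ψ n) := fun n =>
    Function.Surjective.of_comp (g := K.mkQ) (hsurj n)
  refine ⟨d, K, eq_bot_iff.2 fun y hy => ?_, fun n =>
    ⟨(quotEquivOfEq _ _ (hker n).symm).trans ((ψ n).quotKerEquivOfSurjective (hψ n))⟩⟩
  obtain ⟨f, rfl⟩ := K.mkQ_surjective y
  refine (Quotient.mk_eq_zero _).2 ((mem_iInf _).2 fun n => ?_)
  exact (hker n).ge ((mem_iInf _).1 hy n)

end IsLayerTower

end LayerTower

/-! ### The Iwasawa algebra -/

theorem card_primaryComponent_congr {G H : Type*} [AddCommGroup G] [AddCommGroup H] (e : G ≃+ H)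
    (p : ℕ) : Nat.card (AddCommGroup.primaryComponent G p) =
      Nat.card (AddCommGroup.primaryComponent H p) :=
  Nat.card_congr (e.toEquiv.subtypeEquiv fun x => exists_congr fun k => by
    rw [← map_eq_zero_iff e e.injective, map_nsmul]
    rfl)

section IwasawaAlgebra

open scoped Pointwise PowerSeries.WithPiTopology
open PowerSeries

variable {p : ℕ} [Fact p.Prime]

variable (p) in
/-- The element `ω_n = (1 + X) ^ (p ^ n) - 1` of the Iwasawa algebra `ℤ_[p]⟦X⟧`, on which a
generator of the group `ℤ_p` acts as multiplication by `1 + X`. -/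
noncomputable def iwasawaOmega (n : ℕ) : ℤ_[p]⟦X⟧ := (1 + X) ^ p ^ n - 1

variable (p) in
/-- The quotient `ν_n = ω_(n + 1) / ω_n`, the norm element of the `n`-th step of the tower. -/
noncomputable def iwasawaNu (n : ℕ) : ℤ_[p]⟦X⟧ := ∑ i ∈ Finset.range p, ((1 + X) ^ p ^ n) ^ i

theorem iwasawaOmega_succ (n : ℕ) :
    iwasawaOmega p (n + 1) = iwasawaOmega p n * iwasawaNu p n := by
  rw [iwasawaOmega, iwasawaOmega, iwasawaNu, mul_geom_sum, ← pow_mul, ← pow_succ]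

theorem iwasawaOmega_dvd_nu_sub (n : ℕ) : iwasawaOmega p n ∣ iwasawaNu p n - p := by
  have hsum : iwasawaNu p n - p = ∑ i ∈ Finset.range p, (((1 + X) ^ p ^ n) ^ i - 1) := by
    simp [iwasawaNu]
  rw [hsum]
  exact Finset.dvd_sum fun i _ => sub_one_dvd_pow_sub_one _ i

theorem iwasawaOmega_zero_mem_jacobson :
    iwasawaOmega p 0 ∈ Ideal.jacobson (⊥ : Ideal ℤ_[p]⟦X⟧) := by
  rw [IsLocalRing.jacobson_eq_maximalIdeal _ bot_ne_top, IsLocalRing.mem_maximalIdeal,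
    mem_nonunits_iff, isUnit_iff_constantCoeff]
  simp [iwasawaOmega]

variable (p) in
/-- The polynomial `(1 + X) ^ (p ^ n) - 1`, whose image in the Iwasawa algebra is `iwasawaOmega`. -/
noncomputable def iwasawaPoly (n : ℕ) : Polynomial ℤ_[p] := (1 + Polynomial.X) ^ p ^ n - 1

theorem coe_iwasawaPoly (n : ℕ) : (iwasawaPoly p n : ℤ_[p]⟦X⟧) = iwasawaOmega p n := by
  simp [iwasawaPoly, iwasawaOmega]

theorem natDegree_one_add_X_pow (n : ℕ) :
    ((1 + Polynomial.X : Polynomial ℤ_[p]) ^ n).natDegree = n := by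
  rw [Polynomial.natDegree_pow, add_comm, ← Polynomial.C_1, Polynomial.natDegree_X_add_C, mul_one]

theorem natDegree_iwasawaPoly (n : ℕ) : (iwasawaPoly p n).natDegree = p ^ n := by
  rw [iwasawaPoly, ← Polynomial.C_1, Polynomial.natDegree_sub_C, Polynomial.C_1,
    natDegree_one_add_X_pow]

theorem monic_iwasawaPoly (n : ℕ) : (iwasawaPoly p n).Monic := by
  have hmonic : ((1 + Polynomial.X : Polynomial ℤ_[p]) ^ p ^ n).Monic := by
    refine Polynomial.Monic.pow ?_ _
    rw [add_comm, ← Polynomial.C_1]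
    exact Polynomial.monic_X_add_C 1
  refine hmonic.sub_of_left ?_
  rw [Polynomial.degree_one, Polynomial.degree_eq_natDegree hmonic.ne_zero,
    natDegree_one_add_X_pow]
  exact_mod_cast pow_pos (Fact.out (p := p.Prime)).pos n

theorem isDistinguishedAt_iwasawaPoly (n : ℕ) :
    (iwasawaPoly p n).IsDistinguishedAt (IsLocalRing.maximalIdeal ℤ_[p]) where
  monic := monic_iwasawaPoly n
  mem {k} hk := by
    rw [natDegree_iwasawaPoly] at hk
    rw [← PadicInt.ker_toZMod, RingHom.mem_ker, ← Polynomial.coeff_map,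
      iwasawaPoly, Polynomial.map_sub, Polynomial.map_pow, Polynomial.map_add,
      Polynomial.map_one, Polynomial.map_X, add_pow_char_pow, one_pow, add_sub_cancel_left,
      Polynomial.coeff_X_pow, if_neg hk.ne]

/-- By Weierstrass division, the quotient of the Iwasawa algebra by `ω_n` is a quotient of the
polynomial ring. -/
noncomputable def iwasawaQuotientEquiv (n : ℕ) :
    (Polynomial ℤ_[p] ⧸ Ideal.span {iwasawaPoly p n}) ≃ₐ[ℤ_[p]]
      ℤ_[p]⟦X⟧ ⧸ Ideal.span {(iwasawaPoly p n : ℤ_[p]⟦X⟧)} :=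
  (isDistinguishedAt_iwasawaPoly n).algEquivQuotient

theorem finite_padicInt_quotient_span_p : Finite (ℤ_[p] ⧸ Ideal.span {(p : ℤ_[p])}) := by
  rw [← PadicInt.maximalIdeal_eq_span_p]
  exact Finite.of_equiv (ZMod p) PadicInt.residueField.symm.toEquiv

theorem finite_quotient_iwasawaOmega_p (n : ℕ) :
    Finite (ℤ_[p]⟦X⟧ ⧸ Ideal.span {iwasawaOmega p n, (p : ℤ_[p]⟦X⟧)}) := by
  have : Module.Finite ℤ_[p] (Polynomial ℤ_[p] ⧸ Ideal.span {iwasawaPoly p n}) :=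
    (monic_iwasawaPoly n).finite_quotient
  have : Module.Finite ℤ_[p] (ℤ_[p]⟦X⟧ ⧸ Ideal.span {(iwasawaPoly p n : ℤ_[p]⟦X⟧)}) :=
    Module.Finite.equiv (iwasawaQuotientEquiv n).toLinearEquiv
  have hle : Ideal.span {(iwasawaPoly p n : ℤ_[p]⟦X⟧)} ≤
      Ideal.span {iwasawaOmega p n, (p : ℤ_[p]⟦X⟧)} := by
    rw [coe_iwasawaPoly]
    exact Ideal.span_mono (by simp)
  have : Module.Finite ℤ_[p] (ℤ_[p]⟦X⟧ ⧸ Ideal.span {iwasawaOmega p n, (p : ℤ_[p]⟦X⟧)}) :=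
    Module.Finite.of_surjective (Ideal.Quotient.factorₐ ℤ_[p] hle).toLinearMap
      (Ideal.Quotient.factor_surjective hle)
  have := finite_padicInt_quotient_span_p (p := p)
  have := finite_torsionBySet_of_finite_quotient (Ideal.span {(p : ℤ_[p])})
    (E := ℤ_[p]⟦X⟧ ⧸ Ideal.span {iwasawaOmega p n, (p : ℤ_[p]⟦X⟧)})
  refine Finite.of_injective (fun x => (⟨x, ?_⟩ : Submodule.torsionBySet ℤ_[p] _
    (Ideal.span {(p : ℤ_[p])} : Set ℤ_[p]))) fun x y hxy => congrArg Subtype.val hxy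
  rw [Submodule.torsionBySet_ideal_span_singleton_eq, Submodule.mem_torsionBy_iff]
  obtain ⟨x, rfl⟩ := Ideal.Quotient.mk_surjective x
  rw [Nat.cast_smul_eq_nsmul, nsmul_eq_mul, ← map_natCast (Ideal.Quotient.mk _), ← map_mul,
    Ideal.Quotient.eq_zero_iff_mem]
  exact Ideal.mul_mem_right _ _ (Ideal.subset_span (by simp))

theorem IsLayerTower.eventually_card_primaryComponent_le {E : ℕ → Type*}
    [∀ n, AddCommGroup (E n)] [∀ n, Module ℤ_[p]⟦X⟧ (E n)] [∀ n, Module.Finite ℤ_[p]⟦X⟧ (E n)]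
    {π : ∀ n, E (n + 1) →ₗ[ℤ_[p]⟦X⟧] E n} (h : IsLayerTower (iwasawaOmega p) π)
    (hT : ∀ n, Finite (AddCommGroup.primaryComponent (E n) p)) :
    ∀ᶠ n in atTop, Nat.card (AddCommGroup.primaryComponent (E n) p) ≤
      Nat.card (AddCommGroup.primaryComponent (E (n + 1)) p) := by
  have : CompactSpace ℤ_[p]⟦X⟧ := inferInstanceAs (CompactSpace ((Unit →₀ ℕ) → ℤ_[p]))
  obtain ⟨d, K, hsep, e⟩ := h.exists_quotSMulTop_equiv (fun n => ⟨_, iwasawaOmega_succ n⟩)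
    iwasawaOmega_zero_mem_jacobson
  have hcard := fun n => card_primaryComponent_congr (e n).some.toAddEquiv p
  have hfin : ∀ n, Finite (AddCommGroup.primaryComponent
      (QuotSMulTop (iwasawaOmega p n) ((Fin d → ℤ_[p]⟦X⟧) ⧸ K)) p) := fun n =>
    Nat.finite_of_card_ne_zero ((hcard n).trans_ne Nat.card_pos.ne')
  simpa only [hcard] using _root_.eventually_card_primaryComponent_le iwasawaOmega_succ
    iwasawaOmega_dvd_nu_sub finite_quotient_iwasawaOmega_p hsep hfin

end IwasawaAlgebra

/-! ### Towers of coinvariants -/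

/-- A tower of modules `M n` with endomorphisms `t n` of order dividing `p ^ n`, in which `M n` is
the module of coinvariants of `M (n + 1)` under the subgroup of order `p` generated by
`t (n + 1) ^ p ^ n`. -/
structure IsCoinvariantTower {R : Type*} [CommRing R] (p : ℕ) {M : ℕ → Type*}
    [∀ n, AddCommGroup (M n)] [∀ n, Module R (M n)] (t : ∀ n, Module.End R (M n))
    (π : ∀ n, M (n + 1) →ₗ[R] M n) : Prop where
  pow_eq_one n : t n ^ p ^ n = 1
  surjective n : Function.Surjective (π n)
  comp_eq n : π n ∘ₗ t (n + 1) = t n ∘ₗ π n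
  exact n : Function.Exact (t (n + 1) ^ p ^ n - 1 : Module.End R (M (n + 1))) (π n)

theorem IsCoinvariantTower.baseChange {R : Type*} [CommRing R] {p : ℕ} {M : ℕ → Type*}
    [∀ n, AddCommGroup (M n)] [∀ n, Module R (M n)] {t : ∀ n, Module.End R (M n)}
    {π : ∀ n, M (n + 1) →ₗ[R] M n} (h : IsCoinvariantTower p t π) (A : Type*) [CommRing A]
    [Algebra R A] : IsCoinvariantTower p (fun n => (t n).baseChange A)
      fun n => (π n).baseChange A where
  pow_eq_one n := by rw [← LinearMap.baseChange_pow, h.pow_eq_one, LinearMap.baseChange_one]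
  surjective n := LinearMap.lTensor_surjective A (h.surjective n)
  comp_eq n := by rw [← LinearMap.baseChange_comp, h.comp_eq, LinearMap.baseChange_comp]
  exact n := by
    rw [← LinearMap.baseChange_pow, ← LinearMap.baseChange_one, ← LinearMap.baseChange_sub]
    exact lTensor_exact A (h.exact n) (h.surjective n)

section IwasawaAction

open PowerSeries

variable {p : ℕ} [Fact p.Prime] {M M' : Type*} [AddCommGroup M] [Module ℤ_[p] M]
  [AddCommGroup M'] [Module ℤ_[p] M']

theorem aeval_sub_one_eq_zero_of_mem_span {n : ℕ} {t : Module.End ℤ_[p] M} (ht : t ^ p ^ n = 1)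
    {g : Polynomial ℤ_[p]} (hg : g ∈ Ideal.span {iwasawaPoly p n}) :
    Polynomial.aeval (t - 1) g = 0 := by
  obtain ⟨b, rfl⟩ := Ideal.mem_span_singleton'.1 hg
  simp [iwasawaPoly, ht]

/-- The action of the Iwasawa algebra defined by an endomorphism `t` with `t ^ p ^ n = 1`, in which
`X` acts as `t - 1`. -/
noncomputable def iwasawaAction (n : ℕ) (t : Module.End ℤ_[p] M) (ht : t ^ p ^ n = 1) :
    ℤ_[p]⟦X⟧ →+* Module.End ℤ_[p] M :=
  ((Ideal.Quotient.liftₐ (Ideal.span {iwasawaPoly p n}) (Polynomial.aeval (t - 1))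
    fun _ => aeval_sub_one_eq_zero_of_mem_span ht).comp
      (iwasawaQuotientEquiv n).symm.toAlgHom).toRingHom.comp
    (Ideal.Quotient.mk (Ideal.span {(iwasawaPoly p n : ℤ_[p]⟦X⟧)}))

theorem iwasawaQuotientEquiv_mk (n : ℕ) (g : Polynomial ℤ_[p]) :
    iwasawaQuotientEquiv n (Ideal.Quotient.mk _ g) = Ideal.Quotient.mk _ (g : ℤ_[p]⟦X⟧) := by
  simp [iwasawaQuotientEquiv]

theorem iwasawaAction_coe {n : ℕ} {t : Module.End ℤ_[p] M} (ht : t ^ p ^ n = 1)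
    (g : Polynomial ℤ_[p]) :
    iwasawaAction n t ht (g : ℤ_[p]⟦X⟧) = Polynomial.aeval (t - 1) g := by
  have hg := (iwasawaQuotientEquiv n).symm_apply_eq.2 (iwasawaQuotientEquiv_mk n g).symm
  exact congrArg (Ideal.Quotient.liftₐ _ (Polynomial.aeval (t - 1))
    fun _ => aeval_sub_one_eq_zero_of_mem_span ht) hg

theorem iwasawaAction_iwasawaOmega {n : ℕ} {t : Module.End ℤ_[p] M} (ht : t ^ p ^ n = 1) (m : ℕ) :
    iwasawaAction n t ht (iwasawaOmega p m) = t ^ p ^ m - 1 := by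
  rw [← coe_iwasawaPoly, iwasawaAction_coe]
  simp [iwasawaPoly]

theorem exists_eq_coe_add_mul_iwasawaOmega (n : ℕ) (a : ℤ_[p]⟦X⟧) :
    ∃ (g : Polynomial ℤ_[p]) (b : ℤ_[p]⟦X⟧), a = g + b * iwasawaOmega p n := by
  obtain ⟨g', hg⟩ := (iwasawaQuotientEquiv n).surjective (Ideal.Quotient.mk _ a)
  obtain ⟨g, rfl⟩ := Ideal.Quotient.mk_surjective g'
  rw [iwasawaQuotientEquiv_mk, eq_comm, Ideal.Quotient.eq, Ideal.mem_span_singleton',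
    coe_iwasawaPoly] at hg
  obtain ⟨b, hb⟩ := hg
  exact ⟨g, b, by rw [hb, add_sub_cancel]⟩

theorem map_aeval_sub_one {R N N' : Type*} [CommRing R] [AddCommGroup N] [AddCommGroup N']
    [Module R N] [Module R N'] {t : Module.End R N} {t' : Module.End R N'} {f : N →ₗ[R] N'}
    (hf : f ∘ₗ t = t' ∘ₗ f) (g : Polynomial R) (x : N) :
    f (Polynomial.aeval (t - 1) g x) = Polynomial.aeval (t' - 1) g (f x) := by
  have hsub (x : N) : f ((t - 1) x) = (t' - 1) (f x) := by
    simpa using LinearMap.congr_fun hf x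
  induction g using Polynomial.induction_on generalizing x with
  | C a => simp
  | add g₁ g₂ h₁ h₂ => simp [h₁, h₂]
  | monomial k a h =>
    rw [pow_succ, ← mul_assoc, map_mul (Polynomial.aeval (t - 1)) _ Polynomial.X,
      map_mul (Polynomial.aeval (t' - 1)) _ Polynomial.X, Polynomial.aeval_X, Polynomial.aeval_X,
      Module.End.mul_apply, Module.End.mul_apply, h, hsub]

theorem map_iwasawaAction {m n : ℕ} (hmn : n ≤ m) {t : Module.End ℤ_[p] M} (ht : t ^ p ^ m = 1)
    {t' : Module.End ℤ_[p] M'} (ht' : t' ^ p ^ n = 1) {f : M →ₗ[ℤ_[p]] M'}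
    (hf : f ∘ₗ t = t' ∘ₗ f) (a : ℤ_[p]⟦X⟧) (x : M) :
    f (iwasawaAction m t ht a x) = iwasawaAction n t' ht' a (f x) := by
  have hm : t' ^ p ^ m = 1 := by
    rw [← Nat.mul_div_cancel' (pow_dvd_pow p hmn), pow_mul, ht', one_pow]
  obtain ⟨g, b, rfl⟩ := exists_eq_coe_add_mul_iwasawaOmega m a
  simp only [map_add, map_mul, iwasawaAction_iwasawaOmega, ht, hm, sub_self, mul_zero, add_zero,
    iwasawaAction_coe]
  exact map_aeval_sub_one hf g x

/-- The module structure over the Iwasawa algebra given by `iwasawaAction`. -/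
noncomputable abbrev iwasawaModule (n : ℕ) (t : Module.End ℤ_[p] M) (ht : t ^ p ^ n = 1) :
    Module ℤ_[p]⟦X⟧ M :=
  Module.compHom M (iwasawaAction n t ht)

theorem finite_iwasawaModule [Module.Finite ℤ_[p] M] {n : ℕ} {t : Module.End ℤ_[p] M}
    (ht : t ^ p ^ n = 1) :
    letI := iwasawaModule n t ht
    Module.Finite ℤ_[p]⟦X⟧ M := by
  let := iwasawaModule n t ht
  have : IsScalarTower ℤ_[p] ℤ_[p]⟦X⟧ M := IsScalarTower.of_algebraMap_smul fun a x => by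
    have hC : algebraMap ℤ_[p] ℤ_[p]⟦X⟧ a = (Polynomial.C a : Polynomial ℤ_[p]) := by simp
    change iwasawaAction n t ht _ x = _
    rw [hC, iwasawaAction_coe, Polynomial.aeval_C, Module.algebraMap_end_apply]
  exact Module.Finite.of_restrictScalars_finite ℤ_[p] _ _

theorem IsCoinvariantTower.eventually_card_primaryComponent_le {M : ℕ → Type*}
    [∀ n, AddCommGroup (M n)] [∀ n, Module ℤ_[p] (M n)] [∀ n, Module.Finite ℤ_[p] (M n)]
    {t : ∀ n, Module.End ℤ_[p] (M n)} {π : ∀ n, M (n + 1) →ₗ[ℤ_[p]] M n}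
    (h : IsCoinvariantTower p t π)
    (hfin : ∀ n, Finite (AddCommGroup.primaryComponent (M n) p)) :
    ∀ᶠ n in atTop, Nat.card (AddCommGroup.primaryComponent (M n) p) ≤
      Nat.card (AddCommGroup.primaryComponent (M (n + 1)) p) := by
  let (n : ℕ) : Module ℤ_[p]⟦X⟧ (M n) := iwasawaModule n (t n) (h.pow_eq_one n)
  have (n : ℕ) : Module.Finite ℤ_[p]⟦X⟧ (M n) := finite_iwasawaModule (h.pow_eq_one n)
  have hsmul (m n : ℕ) (x : M n) : iwasawaOmega p m • x = (t n ^ p ^ m - 1 : Module.End _ _) x :=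
    LinearMap.congr_fun (iwasawaAction_iwasawaOmega (h.pow_eq_one n) m) x
  let θ (n : ℕ) : M (n + 1) →ₗ[ℤ_[p]⟦X⟧] M n :=
    { toFun := π n
      map_add' := map_add (π n)
      map_smul' := map_iwasawaAction n.le_succ (h.pow_eq_one (n + 1)) (h.pow_eq_one n)
        (h.comp_eq n) }
  have hθ : IsLayerTower (iwasawaOmega p) θ :=
    { surjective := h.surjective
      smul_eq_zero := fun n x => by
        rw [hsmul, h.pow_eq_one, sub_self, LinearMap.zero_apply]
      ker_le := fun n x hx => by
        obtain ⟨y, rfl⟩ := (h.exact n x).1 hx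
        rw [← hsmul]
        exact Submodule.smul_mem_pointwise_smul _ _ _ trivial }
  exact hθ.eventually_card_primaryComponent_le hfin

end IwasawaAction

/-! ### Extension of scalars to the `p`-adic integers -/

section BaseChange

open scoped TensorProduct

variable {p : ℕ} {A : Type*} [AddCommGroup A]

theorem nsmul_torsionBy_eq_zero (m : ℕ) (x : Submodule.torsionBy ℤ A (m : ℤ)) : m • x = 0 := by
  exact_mod_cast Submodule.smul_torsionBy (m : ℤ) x

variable [Fact p.Prime]

theorem exists_eq_natCast_add_pow_mul (k : ℕ) (a : ℤ_[p]) :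
    ∃ (m : ℕ) (b : ℤ_[p]), a = m + p ^ k * b := by
  obtain ⟨b, hb⟩ := Ideal.mem_span_singleton'.1 (PadicInt.appr_spec k a)
  exact ⟨a.appr k, b, by rw [mul_comm, hb, add_sub_cancel]⟩

theorem injective_one_tmul_of_pow_nsmul_eq_zero {k : ℕ} (hA : ∀ x : A, p ^ k • x = 0) :
    Function.Injective fun x : A => (1 : ℤ_[p]) ⊗ₜ[ℤ] x := by
  let : Module (ZMod (p ^ k)) A := AddCommGroup.zmodModule hA
  let f : ℤ_[p] →+ A →+ A :=
    (smulAddHom (ZMod (p ^ k)) A).comp (PadicInt.toZModPow k).toAddMonoidHom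
  let g : ℤ_[p] ⊗[ℤ] A →+ A := TensorProduct.liftAddHom f fun m a x => by
    simp [f, mul_smul, Int.cast_smul_eq_zsmul, smul_comm m]
  refine Function.LeftInverse.injective (g := g) fun x => ?_
  simp [g, f]

theorem surjective_one_tmul_of_pow_nsmul_eq_zero {k : ℕ} (hA : ∀ x : A, p ^ k • x = 0) :
    Function.Surjective fun x : A => (1 : ℤ_[p]) ⊗ₜ[ℤ] x := by
  intro z
  induction z using TensorProduct.induction_on with
  | zero => exact ⟨0, TensorProduct.tmul_zero _ _⟩
  | add z w hz hw =>
    obtain ⟨x, rfl⟩ := hz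
    obtain ⟨y, rfl⟩ := hw
    exact ⟨x + y, TensorProduct.tmul_add _ _ _⟩
  | tmul a x =>
    obtain ⟨m, b, rfl⟩ := exists_eq_natCast_add_pow_mul k a
    have hm : (m : ℤ_[p]) = m • 1 := by rw [nsmul_one]
    have hpb : (p : ℤ_[p]) ^ k * b = p ^ k • b := by rw [nsmul_eq_mul, Nat.cast_pow]
    refine ⟨m • x, ?_⟩
    simp only
    rw [TensorProduct.add_tmul, hm, hpb, TensorProduct.smul_tmul, TensorProduct.smul_tmul, hA,
      TensorProduct.tmul_zero, add_zero]

theorem exists_eq_one_tmul_of_pow_nsmul_eq_zero {k : ℕ} {z : ℤ_[p] ⊗[ℤ] A} (hz : p ^ k • z = 0) :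
    ∃ x : A, p ^ k • x = 0 ∧ (1 : ℤ_[p]) ⊗ₜ[ℤ] x = z := by
  have hexact : Function.Exact (Submodule.torsionBy ℤ A (p ^ k : ℕ)).subtype
      (DistribSMul.toLinearMap ℤ A ((p ^ k : ℕ) : ℤ)) := LinearMap.exact_subtype_ker_map _
  have hmul : (DistribSMul.toLinearMap ℤ A ((p ^ k : ℕ) : ℤ)).lTensor ℤ_[p] z = p ^ k • z := by
    rw [LinearMap.lTensor_smul_action, DistribSMul.toLinearMap_apply, natCast_zsmul]
  obtain ⟨w, rfl⟩ := (Module.Flat.lTensor_exact ℤ_[p] hexact z).1 (hmul.trans hz)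
  obtain ⟨x, rfl⟩ := surjective_one_tmul_of_pow_nsmul_eq_zero (nsmul_torsionBy_eq_zero (p ^ k)) w
  exact ⟨x, congrArg Subtype.val (nsmul_torsionBy_eq_zero (p ^ k) x), rfl⟩

theorem eq_zero_of_one_tmul_eq_zero {k : ℕ} {x : A} (hx : p ^ k • x = 0)
    (h : (1 : ℤ_[p]) ⊗ₜ[ℤ] x = 0) : x = 0 := by
  let y : Submodule.torsionBy ℤ A (p ^ k : ℕ) := ⟨x, by
    rw [Submodule.mem_torsionBy_iff, natCast_zsmul, hx]⟩
  have hy : (1 : ℤ_[p]) ⊗ₜ[ℤ] y = 1 ⊗ₜ 0 :=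
    Module.Flat.lTensor_preserves_injective_linearMap (M := ℤ_[p]) _
      (Submodule.injective_subtype _) (h.trans (by simp))
  exact congrArg Subtype.val
    (injective_one_tmul_of_pow_nsmul_eq_zero (nsmul_torsionBy_eq_zero (p ^ k)) hy)

variable (p A) in
theorem card_primaryComponent_padicInt_tensorProduct :
    Nat.card (AddCommGroup.primaryComponent (ℤ_[p] ⊗[ℤ] A) p) =
      Nat.card (AddCommGroup.primaryComponent A p) := by
  have hmem (x : AddCommGroup.primaryComponent A p) :
      (1 : ℤ_[p]) ⊗ₜ[ℤ] (x : A) ∈ AddCommGroup.primaryComponent (ℤ_[p] ⊗[ℤ] A) p := by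
    obtain ⟨k, hk⟩ := x.2
    exact ⟨k, by rw [← TensorProduct.tmul_smul, hk, TensorProduct.tmul_zero]⟩
  refine (Nat.card_congr (Equiv.ofBijective (fun x => ⟨_, hmem x⟩) ⟨?_, ?_⟩)).symm
  · intro x y hxy
    obtain ⟨k, hk⟩ := (x - y).2
    refine sub_eq_zero.1 (Subtype.ext (eq_zero_of_one_tmul_eq_zero hk ?_))
    rw [AddSubgroup.coe_sub, TensorProduct.tmul_sub, sub_eq_zero]
    exact congrArg Subtype.val hxy
  · rintro ⟨z, k, hz⟩
    obtain ⟨x, hx, rfl⟩ := exists_eq_one_tmul_of_pow_nsmul_eq_zero hz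
    exact ⟨⟨x, k, hx⟩, rfl⟩

end BaseChange

section RestrictRange

variable {R : Type*} [CommRing R] {p : ℕ}

theorem map_mem_range_of_comp_eq {N N' : Type*} [AddCommGroup N] [AddCommGroup N'] [Module R N]
    [Module R N'] {f : N →ₗ[R] N'} {r : Module.End R N} {r' : Module.End R N'}
    (hf : f ∘ₗ r = r' ∘ₗ f) {x : N} (hx : x ∈ LinearMap.range r) : f x ∈ LinearMap.range r' := by
  obtain ⟨y, rfl⟩ := hx
  exact ⟨f y, (LinearMap.congr_fun hf y).symm⟩

theorem IsCoinvariantTower.restrict_range {M : ℕ → Type*} [∀ n, AddCommGroup (M n)]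
    [∀ n, Module R (M n)] {t r : ∀ n, Module.End R (M n)} {π : ∀ n, M (n + 1) →ₗ[R] M n}
    (h : IsCoinvariantTower p t π) (hr : ∀ n, IsIdempotentElem (r n))
    (htr : ∀ n, t n ∘ₗ r n = r n ∘ₗ t n) (hπr : ∀ n, π n ∘ₗ r (n + 1) = r n ∘ₗ π n) :
    IsCoinvariantTower p
      (fun n => (t n).restrict fun _ => map_mem_range_of_comp_eq (htr n))
      (fun n => (π n).restrict fun _ => map_mem_range_of_comp_eq (hπr n)) where
  pow_eq_one n := by
    ext x
    rw [Module.End.pow_restrict, LinearMap.coe_restrict_apply, h.pow_eq_one]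
    rfl
  surjective n z := by
    obtain ⟨y, hy⟩ := h.surjective n z
    refine ⟨⟨r (n + 1) y, y, rfl⟩, Subtype.ext ?_⟩
    refine (LinearMap.congr_fun (hπr n) y).trans ?_
    rw [LinearMap.comp_apply, hy]
    exact (LinearMap.IsIdempotentElem.mem_range_iff (hr n)).1 z.2
  comp_eq n := LinearMap.ext fun x => Subtype.ext (LinearMap.congr_fun (h.comp_eq n) x)
  exact n x := by
    let s : Module.End R (LinearMap.range (r (n + 1))) :=
      (t (n + 1)).restrict fun _ => map_mem_range_of_comp_eq (htr (n + 1))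
    have hpow (y : LinearMap.range (r (n + 1))) :
        ((s ^ p ^ n - 1) y : M (n + 1)) = (t (n + 1) ^ p ^ n - 1) y.1 := by
      rw [Module.End.pow_restrict]
      rfl
    have hcomm : Commute (r (n + 1)) (t (n + 1) ^ p ^ n - 1) :=
      ((show Commute _ _ from (htr (n + 1)).symm).pow_right _).sub_right (.one_right _)
    refine Subtype.ext_iff.trans ((h.exact n x).trans ⟨fun ⟨y, hy⟩ => ?_, fun ⟨y, hy⟩ => ?_⟩)
    · refine ⟨⟨r (n + 1) y, y, rfl⟩, Subtype.ext ((hpow _).trans ?_)⟩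
      rw [← (LinearMap.IsIdempotentElem.mem_range_iff (hr (n + 1))).1 x.2, ← hy]
      exact (LinearMap.congr_fun hcomm.eq y).symm
    · exact ⟨y, (hpow y).symm.trans (congrArg Subtype.val hy)⟩

end RestrictRange

/-! ### Convergence of the orders of torsion subgroups -/

/-- The torsion subgroups of the groups `A n` are finite, and their orders, the orders of their
prime-to-`p` parts and the orders of their `l`-primary parts converge `p`-adically. -/
structure TorsionOrdersConverge (p : ℕ) [Fact p.Prime] (A : ℕ → Type*)
    [∀ n, AddCommGroup (A n)] : Prop where
  finite n : Finite (AddCommGroup.torsion (A n))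
  torsion : ∃ a : ℤ_[p], Tendsto
    (fun n => (Nat.card (AddCommGroup.torsion (A n)) : ℤ_[p])) atTop (𝓝 a)
  nonPTorsion : ∃ a : ℤ_[p], Tendsto
    (fun n => (Nat.card (nonPTorsion (A n) p) : ℤ_[p])) atTop (𝓝 a)
  primaryComponent (l : ℕ) : l.Prime → ∃ a : ℤ_[p], Tendsto
    (fun n => (Nat.card (AddCommGroup.primaryComponent (A n) l) : ℤ_[p])) atTop (𝓝 a)

section Transfer

variable {p : ℕ} [Fact p.Prime] {A B : ℕ → Type*} [∀ n, AddCommGroup (A n)]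
  [∀ n, AddCommGroup (B n)]

theorem TorsionOrdersConverge.of_card_eq (h : TorsionOrdersConverge p B)
    (hcard : ∀ S : Submonoid ℕ, 0 ∉ S → ∀ n,
      Nat.card (Submodule.torsion' ℤ (A n) S) = Nat.card (Submodule.torsion' ℤ (B n) S)) :
    TorsionOrdersConverge p A := by
  have htorsion (n : ℕ) :
      Nat.card (AddCommGroup.torsion (A n)) = Nat.card (AddCommGroup.torsion (B n)) := by
    rw [← torsion'_nonZeroDivisors, ← torsion'_nonZeroDivisors]
    exact hcard _ (by simp) n
  have hnonP (n : ℕ) : Nat.card (_root_.nonPTorsion (A n) p) =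
      Nat.card (_root_.nonPTorsion (B n) p) := by
    rw [← torsion'_coprimeSubmonoid, ← torsion'_coprimeSubmonoid]
    exact hcard _ (zero_notMem_of_le_coprimeSubmonoid (Fact.out : p.Prime).ne_one le_rfl) n
  have hprimary {l : ℕ} (hl : l.Prime) (n : ℕ) :
      Nat.card (AddCommGroup.primaryComponent (A n) l) =
        Nat.card (AddCommGroup.primaryComponent (B n) l) := by
    rw [← torsion'_powers, ← torsion'_powers]
    refine hcard (Submonoid.powers l) ?_ n
    rintro ⟨k, hk⟩
    exact pow_ne_zero k hl.ne_zero hk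
  exact
    { finite := fun n => by
        have := h.finite n
        exact Nat.finite_of_card_ne_zero ((htorsion n).trans_ne Nat.card_pos.ne')
      torsion := by simpa only [htorsion] using h.torsion
      nonPTorsion := by simpa only [hnonP] using h.nonPTorsion
      primaryComponent := fun l hl => by simpa only [hprimary hl] using h.primaryComponent l hl }

theorem torsionOrdersConverge_iff_of_injective {j : ∀ n, A n →+ B n}
    (hj : ∀ n, Function.Injective (j n))
    (hrange : ∀ n, (AddCommGroup.torsion (B n) : Set (B n)) ⊆ Set.range (j n)) :
    TorsionOrdersConverge p A ↔ TorsionOrdersConverge p B :=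
  have hcard (S : Submonoid ℕ) (hS : 0 ∉ S) (n : ℕ) :
      Nat.card (Submodule.torsion' ℤ (A n) S) = Nat.card (Submodule.torsion' ℤ (B n) S) :=
    card_torsion'_eq_of_injective (j := (j n).toIntLinearMap) hS (hj n) (hrange n)
  ⟨fun h => h.of_card_eq fun S hS n => (hcard S hS n).symm, fun h => h.of_card_eq hcard⟩

end Transfer

theorem finite_torsion_of_module_finite (A : Type*) [AddCommGroup A] [Module.Finite ℤ A] :
    Finite (AddCommGroup.torsion A) := by
  have : Finite (Submodule.torsion ℤ A) :=
    Module.finite_of_fg_torsion _ Submodule.torsion_isTorsion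
  refine Finite.Set.subset (Submodule.torsion ℤ A : Set A) fun x hx => ?_
  obtain ⟨m, hm, hmx⟩ := isOfFinAddOrder_iff_nsmul_eq_zero.1 hx
  exact ⟨⟨m, by simpa using hm.ne'⟩, by simpa using hmx⟩

theorem finite_torsion'_of_module_finite (A : Type*) [AddCommGroup A] [Module.Finite ℤ A]
    {S : Submonoid ℕ} (hS : 0 ∉ S) : Finite (Submodule.torsion' ℤ A S) :=
  have := finite_torsion_of_module_finite A
  Finite.Set.subset (AddCommGroup.torsion A : Set A) (torsion'_le_torsion A hS)

namespace IsCoinvariantTower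

open scoped TensorProduct

variable {p : ℕ} [Fact p.Prime] {M : ℕ → Type*} [∀ n, AddCommGroup (M n)]
  [∀ n, Module.Finite ℤ (M n)] {t : ∀ n, Module.End ℤ (M n)} {π : ∀ n, M (n + 1) →ₗ[ℤ] M n}

theorem exists_tendsto_card_torsion' (h : IsCoinvariantTower p t π) {S : Submonoid ℕ}
    (hS : S ≤ coprimeSubmonoid p) : ∃ a : ℤ_[p], Tendsto
      (fun n => (Nat.card (Submodule.torsion' ℤ (M n) S) : ℤ_[p])) atTop (𝓝 a) :=
  tendsto_padicInt_of_modEq fun n =>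
    have := finite_torsion'_of_module_finite (M (n + 1))
      (zero_notMem_of_le_coprimeSubmonoid (Fact.out : p.Prime).ne_one hS)
    card_torsion'_modEq (h.pow_eq_one (n + 1)) (h.surjective n) (h.exact n) hS

theorem exists_tendsto_card_primaryComponent (h : IsCoinvariantTower p t π) :
    ∃ a : ℤ_[p], Tendsto
      (fun n => (Nat.card (AddCommGroup.primaryComponent (M n) p) : ℤ_[p])) atTop (𝓝 a) := by
  have hfin (n : ℕ) : Finite (AddCommGroup.primaryComponent (M n) p) :=
    have := finite_torsion_of_module_finite (M n)
    Finite.Set.subset (AddCommGroup.torsion (M n) : Set (M n))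
      (primaryComponent_le_torsion (M n) (Fact.out : p.Prime).ne_zero)
  have hcard (n : ℕ) := card_primaryComponent_padicInt_tensorProduct p (M n)
  refine tendsto_padicInt_of_eventually_le
    (fun n => exists_card_primaryComponent_eq_pow (M n)) ?_
  simpa only [hcard] using (h.baseChange ℤ_[p]).eventually_card_primaryComponent_le
    fun n => Nat.finite_of_card_ne_zero ((hcard n).trans_ne Nat.card_pos.ne')

theorem torsionOrdersConverge (h : IsCoinvariantTower p t π) : TorsionOrdersConverge p M := by
  have hp : p.Prime := Fact.out
  have hnonP : ∃ a : ℤ_[p], Tendsto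
      (fun n => (Nat.card (nonPTorsion (M n) p) : ℤ_[p])) atTop (𝓝 a) := by
    simp_rw [← torsion'_coprimeSubmonoid]
    exact h.exists_tendsto_card_torsion' le_rfl
  refine ⟨fun n => finite_torsion_of_module_finite (M n), ?_, hnonP, fun l hl => ?_⟩
  · obtain ⟨a, ha⟩ := hnonP
    obtain ⟨b, hb⟩ := h.exists_tendsto_card_primaryComponent
    simp_rw [card_torsion_eq_card_nonPTorsion_mul _ hp, Nat.cast_mul]
    exact ⟨a * b, ha.mul hb⟩
  · obtain rfl | hlp := eq_or_ne l p
    · exact h.exists_tendsto_card_primaryComponent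
    · simp_rw [← torsion'_powers]
      exact h.exists_tendsto_card_torsion'
        (Submonoid.powers_le.2 ((Nat.coprime_primes hl hp).2 hlp))

end IsCoinvariantTower

/-! ### Singular one-chains modulo boundaries -/

section TriangleFace

/-- The `i`-th face of the standard `2`-simplex, parametrised by the unit interval. -/
noncomputable def triangleFace (i : Fin 3) : C(unitInterval, stdSimplex ℝ (Fin 3)) :=
  (⟨stdSimplex.map (Fin.succAbove i), stdSimplex.continuous_map _⟩ :
    C(stdSimplex ℝ (Fin 2), stdSimplex ℝ (Fin 3))).comp
    (stdSimplexHomeomorphUnitInterval.symm : C(unitInterval, stdSimplex ℝ (Fin 2)))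

theorem triangleFace_apply (i : Fin 3) (t : unitInterval) (j : Fin 3) :
    triangleFace i t j =
      (if i.succAbove 0 = j then 1 - (t : ℝ) else 0) +
        if i.succAbove 1 = j then (t : ℝ) else 0 := by
  change FunOnFinite.linearMap ℝ ℝ (Fin.succAbove i) _ j = _
  rw [FunOnFinite.linearMap_apply_apply, Finset.sum_filter, Fin.sum_univ_two]
  rfl

theorem coe_triangleFace_zero (t : unitInterval) :
    (triangleFace 0 t : Fin 3 → ℝ) = ![0, 1 - (t : ℝ), (t : ℝ)] := by
  ext j
  rw [triangleFace_apply, show (0 : Fin 3).succAbove 0 = 1 by decide,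
    show (0 : Fin 3).succAbove 1 = 2 by decide]
  fin_cases j <;> simp

theorem coe_triangleFace_one (t : unitInterval) :
    (triangleFace 1 t : Fin 3 → ℝ) = ![1 - (t : ℝ), 0, (t : ℝ)] := by
  ext j
  rw [triangleFace_apply, show (1 : Fin 3).succAbove 0 = 0 by decide,
    show (1 : Fin 3).succAbove 1 = 2 by decide]
  fin_cases j <;> simp

theorem coe_triangleFace_two (t : unitInterval) :
    (triangleFace 2 t : Fin 3 → ℝ) = ![1 - (t : ℝ), (t : ℝ), 0] := by
  ext j
  rw [triangleFace_apply, show (2 : Fin 3).succAbove 0 = 0 by decide,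
    show (2 : Fin 3).succAbove 1 = 1 by decide]
  fin_cases j <;> simp

theorem triangleFace_zero_zero : triangleFace 0 0 = triangleFace 2 1 := by
  ext j
  rw [coe_triangleFace_zero, coe_triangleFace_two]
  fin_cases j <;> simp

theorem triangleFace_one_zero : triangleFace 1 0 = triangleFace 2 0 := by
  ext j
  rw [coe_triangleFace_one, coe_triangleFace_two]
  fin_cases j <;> simp

theorem triangleFace_one_one : triangleFace 1 1 = triangleFace 0 1 := by
  ext j
  rw [coe_triangleFace_one, coe_triangleFace_zero]
  fin_cases j <;> simp

end TriangleFace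

section EdgeGroup

/-- The boundary of a singular triangle, as a `1`-chain of paths. -/
noncomputable def triangleBoundary {Y : Type*} [TopologicalSpace Y]
    (τ : C(stdSimplex ℝ (Fin 3), Y)) : C(unitInterval, Y) →₀ ℤ :=
  Finsupp.single (τ.comp (triangleFace 0)) 1 - Finsupp.single (τ.comp (triangleFace 1)) 1 +
    Finsupp.single (τ.comp (triangleFace 2)) 1

/-- Singular `1`-chains modulo boundaries. The first homology is the kernel of the boundary map
from this group to `0`-chains. -/
abbrev EdgeGroup (Y : Type*) [TopologicalSpace Y] : Type _ :=
  (C(unitInterval, Y) →₀ ℤ) ⧸ Submodule.span ℤ (Set.range (triangleBoundary (Y := Y)))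

namespace EdgeGroup

variable {Y Z W : Type*} [TopologicalSpace Y] [TopologicalSpace Z] [TopologicalSpace W]

/-- The class of a path in the group of singular `1`-chains modulo boundaries. -/
noncomputable def edge (γ : C(unitInterval, Y)) : EdgeGroup Y :=
  Submodule.mkQ _ (Finsupp.single γ 1)

theorem edge_triangle (τ : C(stdSimplex ℝ (Fin 3), Y)) :
    edge (τ.comp (triangleFace 0)) + edge (τ.comp (triangleFace 2)) =
      edge (τ.comp (triangleFace 1)) := by
  have hmem : Submodule.mkQ (Submodule.span ℤ (Set.range (triangleBoundary (Y := Y))))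
      (triangleBoundary τ) = 0 :=
    (Submodule.Quotient.mk_eq_zero _).2 (Submodule.subset_span ⟨τ, rfl⟩)
  rw [triangleBoundary, map_add, map_sub] at hmem
  rw [← sub_eq_zero, ← hmem]
  simp only [edge]
  abel

theorem span_range_edge : Submodule.span ℤ (Set.range (edge (Y := Y))) = ⊤ := by
  have hrange : Set.range (edge (Y := Y)) =
      Submodule.mkQ _ '' Set.range fun γ => Finsupp.single γ (1 : ℤ) := by
    rw [← Set.range_comp]
    rfl
  rw [hrange, ← Submodule.map_span, ← Finsupp.coe_basisSingleOne, Module.Basis.span_eq,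
    Submodule.map_top, Submodule.range_mkQ]

section Lift

variable {A : Type*} [AddCommGroup A] [Module ℤ A]

theorem hom_ext {f g : EdgeGroup Y →ₗ[ℤ] A} (h : ∀ γ, f (edge γ) = g (edge γ)) : f = g :=
  LinearMap.ext_on_range span_range_edge h

/-- The homomorphism determined by a function on paths which is additive on triangles. -/
noncomputable def lift (f : C(unitInterval, Y) → A)
    (hf : ∀ τ : C(stdSimplex ℝ (Fin 3), Y),
      f (τ.comp (triangleFace 0)) + f (τ.comp (triangleFace 2)) = f (τ.comp (triangleFace 1))) :
    EdgeGroup Y →ₗ[ℤ] A :=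
  Submodule.liftQ _ (Finsupp.linearCombination ℤ f) <| by
    obtain rfl := Subsingleton.elim ‹Module ℤ A› (AddCommGroup.toIntModule A)
    rw [Submodule.span_le]
    rintro _ ⟨τ, rfl⟩
    rw [SetLike.mem_coe, LinearMap.mem_ker, triangleBoundary, map_add, map_sub]
    simp only [Finsupp.linearCombination_single, one_smul]
    rw [← hf]
    abel

@[simp]
theorem lift_edge (f : C(unitInterval, Y) → A) (hf) (γ : C(unitInterval, Y)) :
    lift f hf (edge γ) = f γ := by
  obtain rfl := Subsingleton.elim ‹Module ℤ A› (AddCommGroup.toIntModule A)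
  rw [lift, edge, Submodule.mkQ_apply, Submodule.liftQ_apply, Finsupp.linearCombination_single,
    one_smul]

end Lift

/-- The homomorphism induced by a continuous map. -/
noncomputable def map (f : C(Y, Z)) : EdgeGroup Y →ₗ[ℤ] EdgeGroup Z :=
  lift (fun γ => edge (f.comp γ)) fun τ => edge_triangle (f.comp τ)

@[simp]
theorem map_edge (f : C(Y, Z)) (γ : C(unitInterval, Y)) : map f (edge γ) = edge (f.comp γ) :=
  lift_edge _ _ _

theorem map_comp (g : C(Z, W)) (f : C(Y, Z)) : map (g.comp f) = map g ∘ₗ map f :=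
  hom_ext fun γ => by simp [ContinuousMap.comp_assoc]

theorem map_id : map (ContinuousMap.id Y) = LinearMap.id :=
  hom_ext fun γ => by simp

variable (Y) in
/-- The boundary map to singular `0`-chains. -/
noncomputable def boundary : EdgeGroup Y →ₗ[ℤ] (Y →₀ ℤ) :=
  lift (fun γ => Finsupp.single (γ 1) 1 - Finsupp.single (γ 0) 1) fun τ => by
    simp only [ContinuousMap.comp_apply, triangleFace_zero_zero, triangleFace_one_zero,
      triangleFace_one_one]
    abel

@[simp]
theorem boundary_edge (γ : C(unitInterval, Y)) :
    boundary Y (edge γ) = Finsupp.single (γ 1) 1 - Finsupp.single (γ 0) 1 :=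
  lift_edge _ _ _

theorem boundary_eq_zero_of_mem_torsion {q : EdgeGroup Y}
    (hq : q ∈ AddCommGroup.torsion (EdgeGroup Y)) : boundary Y q = 0 :=
  (isOfFinAddOrder_iff_eq_zero _).1 ((boundary Y).toAddMonoidHom.isOfFinAddOrder hq)

end EdgeGroup

end EdgeGroup

/-! ### Comparison with singular homology -/

section Comparison

open CategoryTheory Limits Simplicial EdgeGroup

/-- The coefficients of `H1`. -/
noncomputable abbrev integerCoefficients : ModuleCat.{u} ℤ := ModuleCat.of ℤ (ULift.{u} ℤ)

/-- The singular chain complex whose homology is `H1`. -/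
noncomputable abbrev singularChains (Y : TopCat.{u}) : ChainComplex (ModuleCat.{u} ℤ) ℕ :=
  (TopCat.toSSet.obj Y).chainComplex integerCoefficients.{u}

/-- The morphism out of the coefficients of `H1` which sends `1` to a given element. -/
noncomputable def coeffHom {A : ModuleCat.{u} ℤ} (a : A) : integerCoefficients.{u} ⟶ A :=
  ModuleCat.ofHom ((LinearMap.toSpanSingleton ℤ A a).comp ULift.moduleEquiv.toLinearMap)

theorem coeffHom_apply {A : ModuleCat.{u} ℤ} (a : A) (r : integerCoefficients.{u}) :
    (coeffHom a).hom r = r.down • a :=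
  int_smul_eq_zsmul A.isModule r.down a

theorem coeffHom_up_one {A : ModuleCat.{u} ℤ} (a : A) : (coeffHom a).hom (ULift.up 1) = a :=
  (coeffHom_apply a _).trans (one_zsmul a)

theorem coeffHom_hom_ext {A : ModuleCat.{u} ℤ} {f g : integerCoefficients.{u} ⟶ A}
    (h : f.hom (ULift.up 1) = g.hom (ULift.up 1)) : f = g := by
  ext r
  have hr : r = r.down • (ULift.up 1 : ULift.{u} ℤ) := ULift.ext _ _ (by simp)
  rw [hr, map_zsmul, map_zsmul, h]

variable (Y : TopCat.{u})

theorem eq_zero_of_isOfFinAddOrder_singularChains {k : ℕ} {x : (singularChains Y).X k}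
    (hx : IsOfFinAddOrder x) : x = 0 := by
  classical
  let e := ((TopCat.toSSet.obj Y).isColimitChainComplexXCofan
    integerCoefficients.{u} k).coconePointUniqueUpToIso
      (ModuleCat.coproductCoconeIsColimit (R := ℤ)
        fun _ : (TopCat.toSSet.obj Y) _⦋k⦌ => integerCoefficients.{u})
  let f : (singularChains Y).X k ≃ₗ[ℤ]
    DirectSum ((TopCat.toSSet.obj Y) _⦋k⦌) (fun _ => ULift.{u} ℤ) := e.toLinearEquiv
  refine (map_eq_zero_iff f f.injective).1 (DFinsupp.ext fun i => ULift.down_injective ?_)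
  exact (isOfFinAddOrder_iff_eq_zero _).1 (((AddEquiv.ulift (α := ℤ)).toAddMonoidHom.comp
    ((DirectSum.component ℤ _ _ i).comp f.toLinearMap).toAddMonoidHom).isOfFinAddOrder hx)

/-- Singular `1`-simplices are paths. -/
noncomputable def pathEquiv : (TopCat.toSSet.obj Y) _⦋1⦌ ≃ C(unitInterval, Y) :=
  (TopCat.toSSetObjEquiv Y (.op ⦋1⦌)).trans
    (stdSimplexHomeomorphUnitInterval.continuousMapCongr (.refl _))

theorem pathEquiv_δ (τ : (TopCat.toSSet.obj Y) _⦋2⦌) (i : Fin 3) :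
    pathEquiv Y ((TopCat.toSSet.obj Y).δ i τ) =
      (TopCat.toSSetObjEquiv Y (.op ⦋2⦌) τ).comp (triangleFace i) := rfl

variable {Y} in
theorem ιChainComplex_d_comp_two {A : ModuleCat.{u} ℤ} (f : (singularChains Y).X 1 ⟶ A)
    (τ : (TopCat.toSSet.obj Y) _⦋2⦌) :
    (TopCat.toSSet.obj Y).ιChainComplex τ ≫ (singularChains Y).d 2 1 ≫ f =
      (TopCat.toSSet.obj Y).ιChainComplex ((TopCat.toSSet.obj Y).δ 0 τ) ≫ f -
        (TopCat.toSSet.obj Y).ιChainComplex ((TopCat.toSSet.obj Y).δ 1 τ) ≫ f +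
        (TopCat.toSSet.obj Y).ιChainComplex ((TopCat.toSSet.obj Y).δ 2 τ) ≫ f := by
  rw [← Category.assoc, SSet.ιChainComplex_d, Preadditive.sum_comp, Fin.sum_univ_three]
  simp [sub_eq_add_neg]

/-- The class of a path in singular `1`-chains modulo boundaries. -/
noncomputable def opcyclesEdge (γ : C(unitInterval, Y)) : (singularChains Y).opcycles 1 :=
  ((TopCat.toSSet.obj Y).ιChainComplex ((pathEquiv Y).symm γ) ≫
    (singularChains Y).pOpcycles 1).hom (ULift.up 1)

theorem opcyclesEdge_triangle (τ : C(stdSimplex ℝ (Fin 3), Y)) :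
    opcyclesEdge Y (τ.comp (triangleFace 0)) + opcyclesEdge Y (τ.comp (triangleFace 2)) =
      opcyclesEdge Y (τ.comp (triangleFace 1)) := by
  obtain ⟨τ, rfl⟩ := (TopCat.toSSetObjEquiv Y (.op ⦋2⦌)).surjective τ
  have h := ιChainComplex_d_comp_two ((singularChains Y).pOpcycles 1) τ
  rw [HomologicalComplex.d_pOpcycles, comp_zero] at h
  have h_one := congrArg (fun f => f.hom (ULift.up 1)) h
  simp only [ModuleCat.hom_add, ModuleCat.hom_sub, LinearMap.add_apply, LinearMap.sub_apply,
    ModuleCat.hom_zero, LinearMap.zero_apply] at h_one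
  simp only [opcyclesEdge, ← pathEquiv_δ, Equiv.symm_apply_apply]
  rw [← sub_eq_zero, h_one]
  abel

/-- The comparison map from the edge group to the singular `1`-chains modulo boundaries of the
singular chain complex. -/
noncomputable def edgeGroupToOpcycles :
    ModuleCat.of ℤ (EdgeGroup Y) ⟶ (singularChains Y).opcycles 1 :=
  ModuleCat.ofHom (lift (opcyclesEdge Y) (opcyclesEdge_triangle Y))

theorem edgeGroupToOpcycles_edge (γ : C(unitInterval, Y)) :
    (edgeGroupToOpcycles Y).hom (edge γ) = opcyclesEdge Y γ :=
  lift_edge _ (opcyclesEdge_triangle Y) γ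

/-- The map from singular `1`-chains to the edge group. -/
noncomputable def chainsToEdgeGroup : (singularChains Y).X 1 ⟶ ModuleCat.of ℤ (EdgeGroup Y) :=
  Sigma.desc fun σ : (TopCat.toSSet.obj Y) _⦋1⦌ =>
    coeffHom (A := ModuleCat.of ℤ (EdgeGroup Y)) (edge (pathEquiv Y σ))

theorem ι_chainsToEdgeGroup (σ : (TopCat.toSSet.obj Y) _⦋1⦌) :
    (TopCat.toSSet.obj Y).ιChainComplex σ ≫ chainsToEdgeGroup Y =
      coeffHom (A := ModuleCat.of ℤ (EdgeGroup Y)) (edge (pathEquiv Y σ)) :=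
  Sigma.ι_desc _ _

theorem d_chainsToEdgeGroup : (singularChains Y).d 2 1 ≫ chainsToEdgeGroup Y = 0 := by
  refine SSet.chainComplex_hom_ext fun τ => ?_
  rw [ιChainComplex_d_comp_two, ι_chainsToEdgeGroup, ι_chainsToEdgeGroup, ι_chainsToEdgeGroup,
    comp_zero]
  refine coeffHom_hom_ext ?_
  simp only [ModuleCat.hom_add, ModuleCat.hom_sub, LinearMap.add_apply, LinearMap.sub_apply,
    ModuleCat.hom_zero, LinearMap.zero_apply]
  erw [coeffHom_up_one, coeffHom_up_one, coeffHom_up_one, pathEquiv_δ, pathEquiv_δ, pathEquiv_δ,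
    ← edge_triangle]
  abel

/-- Singular `1`-chains modulo boundaries in the singular chain complex are the edge group. -/
noncomputable def opcyclesIsoEdgeGroup :
    (singularChains Y).opcycles 1 ≅ ModuleCat.of ℤ (EdgeGroup Y) where
  hom := (singularChains Y).descOpcycles (chainsToEdgeGroup Y) 2 (by simp) (d_chainsToEdgeGroup Y)
  inv := edgeGroupToOpcycles Y
  hom_inv_id := by
    rw [← cancel_epi ((singularChains Y).pOpcycles 1), HomologicalComplex.p_descOpcycles_assoc,
      Category.comp_id]
    refine SSet.chainComplex_hom_ext fun σ => coeffHom_hom_ext ?_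
    rw [← Category.assoc, ι_chainsToEdgeGroup, ModuleCat.comp_apply, coeffHom_up_one]
    exact (edgeGroupToOpcycles_edge Y _).trans (by rw [opcyclesEdge, Equiv.symm_apply_apply])
  inv_hom_id := by
    refine ModuleCat.hom_ext (hom_ext fun γ => ?_)
    have hγ : ((TopCat.toSSet.obj Y).ιChainComplex ((pathEquiv Y).symm γ) ≫
        (singularChains Y).pOpcycles 1) ≫ (singularChains Y).descOpcycles (chainsToEdgeGroup Y) 2
          (by simp) (d_chainsToEdgeGroup Y) =
        coeffHom (A := ModuleCat.of ℤ (EdgeGroup Y)) (edge γ) := by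
      rw [Category.assoc, HomologicalComplex.p_descOpcycles, ι_chainsToEdgeGroup,
        Equiv.apply_symm_apply]
    rw [ModuleCat.hom_comp, LinearMap.comp_apply, edgeGroupToOpcycles_edge]
    exact (congrArg (fun f => f.hom (ULift.up 1)) hγ).trans (coeffHom_up_one _)

theorem exists_injective_H1_edgeGroup : ∃ j : H1 Y →+ EdgeGroup Y, Function.Injective j ∧
    (AddCommGroup.torsion (EdgeGroup Y) : Set (EdgeGroup Y)) ⊆ Set.range j := by
  let K := singularChains Y
  let ι : K.homology 1 ⟶ ModuleCat.of ℤ (EdgeGroup Y) :=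
    K.homologyι 1 ≫ (opcyclesIsoEdgeGroup Y).hom
  refine ⟨ι.hom.toAddMonoidHom, (ModuleCat.mono_iff_injective ι).1 inferInstance, fun q hq => ?_⟩
  let x : K.opcycles 1 := (opcyclesIsoEdgeGroup Y).inv.hom q
  have hx : (K.fromOpcycles 1 0).hom x = 0 :=
    eq_zero_of_isOfFinAddOrder_singularChains Y
      (((opcyclesIsoEdgeGroup Y).inv ≫ K.fromOpcycles 1 0).hom.toAddMonoidHom.isOfFinAddOrder hq)
  have hexact : (ShortComplex.mk _ _ (K.homologyι_comp_fromOpcycles 1 0)).Exact :=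
    ShortComplex.exact_of_f_is_kernel _ (K.homologyIsKernel 1 0 (by simp))
  obtain ⟨y, hy⟩ := (ShortComplex.moduleCat_exact_iff _).1 hexact x hx
  exact ⟨y, (congrArg (opcyclesIsoEdgeGroup Y).hom.hom hy).trans
    (congrArg (fun f => f.hom q) (opcyclesIsoEdgeGroup Y).inv_hom_id)⟩

end Comparison

/-! ### Subdivision and local potentials -/

section EdgeGeometry

open unitInterval

namespace EdgeGroup

variable {Y : Type*} [TopologicalSpace Y]

theorem edge_add_of_triangle (τ : C(stdSimplex ℝ (Fin 3), Y)) {α β γ : C(I, Y)}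
    (hα : ∀ t, τ (triangleFace 2 t) = α t) (hβ : ∀ t, τ (triangleFace 0 t) = β t)
    (hγ : ∀ t, τ (triangleFace 1 t) = γ t) : edge α + edge β = edge γ := by
  obtain rfl : τ.comp (triangleFace 2) = α := ContinuousMap.ext hα
  obtain rfl : τ.comp (triangleFace 0) = β := ContinuousMap.ext hβ
  obtain rfl : τ.comp (triangleFace 1) = γ := ContinuousMap.ext hγ
  rw [add_comm, edge_triangle]

theorem edge_const (y : Y) : edge (ContinuousMap.const I y) = 0 :=
  add_eq_left.1 (edge_add_of_triangle (β := ContinuousMap.const I y) (γ := ContinuousMap.const I y)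
    (ContinuousMap.const _ y) (fun _ => rfl) (fun _ => rfl) fun _ => rfl)

/-- The retraction of the real line onto the unit interval. -/
noncomputable def clamp : C(ℝ, I) := ⟨Set.projIcc 0 1 zero_le_one, continuous_projIcc⟩

theorem clamp_coe (t : I) : clamp (t : ℝ) = t :=
  Set.projIcc_val zero_le_one t

theorem clamp_zero : clamp 0 = 0 := clamp_coe 0

theorem clamp_one : clamp 1 = 1 := clamp_coe 1

/-- A barycentric coordinate on the standard `2`-simplex. -/
noncomputable def simplexCoord (i : Fin 3) : C(stdSimplex ℝ (Fin 3), ℝ) :=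
  ⟨fun x => x.1 i, (continuous_apply i).comp continuous_subtype_val⟩

theorem simplexCoord_triangleFace_zero (t : I) (i : Fin 3) :
    simplexCoord i (triangleFace 0 t) = ![0, 1 - (t : ℝ), (t : ℝ)] i :=
  congrFun (coe_triangleFace_zero t) i

theorem simplexCoord_triangleFace_one (t : I) (i : Fin 3) :
    simplexCoord i (triangleFace 1 t) = ![1 - (t : ℝ), 0, (t : ℝ)] i :=
  congrFun (coe_triangleFace_one t) i

theorem simplexCoord_triangleFace_two (t : I) (i : Fin 3) :
    simplexCoord i (triangleFace 2 t) = ![1 - (t : ℝ), (t : ℝ), 0] i :=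
  congrFun (coe_triangleFace_two t) i

theorem edge_square (H : C(I × I, Y)) {α β γ δ : C(I, Y)} (hα : ∀ t, H (t, 0) = α t)
    (hβ : ∀ t, H (1, t) = β t) (hγ : ∀ t, H (0, t) = γ t) (hδ : ∀ t, H (t, 1) = δ t) :
    edge α + edge β = edge γ + edge δ := by
  let diag : C(I, Y) := H.comp ((ContinuousMap.id I).prodMk (ContinuousMap.id I))
  have lower : edge α + edge β = edge diag := by
    refine edge_add_of_triangle (H.comp ((clamp.comp (simplexCoord 1 + simplexCoord 2)).prodMk
      (clamp.comp (simplexCoord 2)))) (fun t => ?_) (fun t => ?_) (fun t => ?_)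
    · simp [simplexCoord_triangleFace_two, clamp_coe, clamp_zero, hα]
    · simp [simplexCoord_triangleFace_zero, clamp_coe, clamp_one, hβ]
    · simp [simplexCoord_triangleFace_one, clamp_coe, diag]
  have upper : edge γ + edge δ = edge diag := by
    refine edge_add_of_triangle (H.comp ((clamp.comp (simplexCoord 2)).prodMk
      (clamp.comp (simplexCoord 1 + simplexCoord 2)))) (fun t => ?_) (fun t => ?_) (fun t => ?_)
    · simp [simplexCoord_triangleFace_two, clamp_coe, clamp_zero, hγ]
    · simp [simplexCoord_triangleFace_zero, clamp_coe, clamp_one, hδ]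
    · simp [simplexCoord_triangleFace_one, clamp_coe, diag]
  rw [lower, upper]

/-- The restriction of a path to a subinterval, reparametrised affinely. -/
noncomputable def segment (γ : C(I, Y)) (a b : I) : C(I, Y) :=
  γ.comp (clamp.comp ⟨fun t : I => (1 - (t : ℝ)) * a + t * b, by fun_prop⟩)

theorem segment_zero_one (γ : C(I, Y)) : segment γ 0 1 = γ := by
  ext t
  simp [segment, clamp_coe]

theorem edge_segment_add (γ : C(I, Y)) (a b c : I) :
    edge (segment γ a b) + edge (segment γ b c) = edge (segment γ a c) := by
  refine edge_add_of_triangle (γ.comp (clamp.comp ((a : ℝ) • simplexCoord 0 +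
    (b : ℝ) • simplexCoord 1 + (c : ℝ) • simplexCoord 2))) (fun t => ?_) (fun t => ?_) (fun t => ?_)
  · simp [simplexCoord_triangleFace_two, segment, mul_comm]
  · simp [simplexCoord_triangleFace_zero, segment, mul_comm]
  · simp [simplexCoord_triangleFace_one, segment, mul_comm]

theorem edge_segment_self (γ : C(I, Y)) (a : I) : edge (segment γ a a) = 0 :=
  add_eq_left.1 (edge_segment_add γ a a a)

theorem edge_segment_eq_sum (γ : C(I, Y)) (t : ℕ → I) (n : ℕ) :
    edge (segment γ (t 0) (t n)) = ∑ k ∈ Finset.range n, edge (segment γ (t k) (t (k + 1))) := by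
  induction n with
  | zero => simp [edge_segment_self]
  | succ n ih => rw [Finset.sum_range_succ, ← ih, edge_segment_add]

theorem range_segment_subset (γ : C(I, Y)) {a b : I} (hab : a ≤ b) :
    Set.range (segment γ a b) ⊆ γ '' Set.Icc a b := by
  rintro _ ⟨s, rfl⟩
  have hab' : (a : ℝ) ≤ b := hab
  have hle : (a : ℝ) ≤ (1 - (s : ℝ)) * a + s * b := by nlinarith [s.2.1]
  have hge : (1 - (s : ℝ)) * a + s * b ≤ b := by nlinarith [s.2.2]
  let r : I := ⟨(1 - (s : ℝ)) * a + s * b, a.2.1.trans hle, hge.trans b.2.2⟩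
  exact ⟨r, ⟨hle, hge⟩, (congrArg γ (clamp_coe r)).symm⟩

theorem span_edge_of_isOpen_cover {ι : Type*} {V : ι → Set Y} (hV : ∀ i, IsOpen (V i))
    (hcover : ∀ y, ∃ i, y ∈ V i) :
    Submodule.span ℤ (edge '' {γ : C(I, Y) | ∃ i, Set.range γ ⊆ V i}) = ⊤ := by
  rw [eq_top_iff, ← span_range_edge, Submodule.span_le]
  rintro _ ⟨γ, rfl⟩
  obtain ⟨t, ht0, htm, ⟨n, hn⟩, htc⟩ := exists_monotone_Icc_subset_open_cover_unitInterval
    (c := fun i => γ ⁻¹' V i) (fun i => (hV i).preimage γ.continuous)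
    (fun s _ => Set.mem_iUnion.2 (hcover (γ s)))
  have hγ : edge γ = ∑ k ∈ Finset.range n, edge (segment γ (t k) (t (k + 1))) := by
    rw [← edge_segment_eq_sum, ht0, hn n le_rfl, segment_zero_one]
  rw [SetLike.mem_coe, hγ]
  refine sum_mem fun k _ => Submodule.subset_span ⟨_, ?_, rfl⟩
  obtain ⟨i, hi⟩ := htc k
  exact ⟨i, (range_segment_subset γ (htm k.le_succ)).trans (Set.image_subset_iff.2 hi)⟩

/-- A potential on `U` computes the class of every path in `U` from its end points. -/
def IsPotentialOn (g : Y → EdgeGroup Y) (U : Set Y) : Prop :=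
  ∀ γ : C(I, Y), Set.range γ ⊆ U → edge γ = g (γ 1) - g (γ 0)

theorem exists_isPotentialOn_of_nullhomotopic {U : Set Y}
    (hU : (⟨Subtype.val, continuous_subtype_val⟩ : C(U, Y)).Nullhomotopic) :
    ∃ g, IsPotentialOn g U := by
  classical
  obtain ⟨y, ⟨F⟩⟩ := hU
  let g : Y → EdgeGroup Y := fun w =>
    if h : w ∈ U then -edge (F.evalAt ⟨w, h⟩).toContinuousMap else 0
  have hg : ∀ w : U, g w = -edge (F.evalAt w).toContinuousMap := fun w => dif_pos w.2
  refine ⟨g, fun γ hγ => ?_⟩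
  let γU : C(I, U) := ⟨fun t => ⟨γ t, hγ ⟨t, rfl⟩⟩, by fun_prop⟩
  -- The contraction moves `γ` along the square `(s, t) ↦ F (t, γ s)` to a constant path.
  have hsquare := edge_square (F.toContinuousMap.comp
      (ContinuousMap.snd.prodMk (γU.comp ContinuousMap.fst))) (α := γ)
    (β := (F.evalAt (γU 1)).toContinuousMap) (γ := (F.evalAt (γU 0)).toContinuousMap)
    (δ := ContinuousMap.const I y) (fun t => F.apply_zero _) (fun _ => rfl) (fun _ => rfl)
    fun t => F.apply_one _
  rw [edge_const, add_zero] at hsquare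
  change edge γ = g (γU 1) - g (γU 0)
  rw [hg, hg, ← hsquare]
  abel

theorem exists_isPotentialOn [StronglyLocallyContractibleSpace Y] (y : Y) :
    ∃ U, IsOpen U ∧ y ∈ U ∧ ∃ g : Y → EdgeGroup Y, IsPotentialOn g U := by
  obtain ⟨S, ⟨hSy, hS⟩, -⟩ := (contractible_basis y).mem_iff.1 univ_mem
  obtain ⟨g, hg⟩ := exists_isPotentialOn_of_nullhomotopic
    ((id_nullhomotopic S).comp_right ⟨Subtype.val, continuous_subtype_val⟩)
  exact ⟨interior S, isOpen_interior, mem_interior_iff_mem_nhds.2 hSy, g,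
    fun γ hγ => hg γ (hγ.trans interior_subset)⟩

section Potential

variable [LocallyPathConnectedSpace Y] {U V : Set Y} {g h : Y → EdgeGroup Y}

theorem IsPotentialOn.eventually_sub_eq (hg : IsPotentialOn g U) (hh : IsPotentialOn h V) {x : Y}
    (hU : U ∈ 𝓝 x) (hV : V ∈ 𝓝 x) : ∀ᶠ y in 𝓝 x, g y - h y = g x - h x := by
  obtain ⟨W, ⟨hWx, hWpc⟩, hWsub⟩ := (path_connected_basis x).mem_iff.1 (inter_mem hU hV)
  filter_upwards [hWx] with y hy
  obtain ⟨γ, hγ⟩ := hWpc.joinedIn x (mem_of_mem_nhds hWx) y hy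
  have hγW : Set.range γ ⊆ U ∩ V := (Set.range_subset_iff.2 hγ).trans hWsub
  have hgh : g y - g x = h y - h x := by
    simpa using (hg γ.toContinuousMap (hγW.trans Set.inter_subset_left)).symm.trans
      (hh γ.toContinuousMap (hγW.trans Set.inter_subset_right))
  rw [sub_eq_sub_iff_add_eq_add] at hgh ⊢
  rw [hgh, add_comm]

theorem IsPotentialOn.finite_image_sub (hg : IsPotentialOn g U) (hh : IsPotentialOn h V)
    (hU : IsOpen U) (hV : IsOpen V) {K : Set Y} (hK : IsCompact K) (hKU : K ⊆ U) (hKV : K ⊆ V) :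
    ((fun x => g x - h x) '' K).Finite := by
  have : CompactSpace K := isCompact_iff_compactSpace.1 hK
  have hloc : IsLocallyConstant fun x : K => g x - h x :=
    (IsLocallyConstant.iff_eventually_eq _).2 fun x =>
      continuous_subtype_val.continuousAt.eventually
      (hg.eventually_sub_eq hh (hU.mem_nhds (hKU x.2)) (hV.mem_nhds (hKV x.2)))
  refine hloc.range_finite.subset ?_
  rintro _ ⟨x, hx, rfl⟩
  exact ⟨⟨x, hx⟩, rfl⟩

end Potential

variable (Y) in
theorem exists_compact_cover_with_potentials [CompactSpace Y] [T2Space Y]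
    [StronglyLocallyContractibleSpace Y] :
    ∃ (F : Finset Y) (K : F → Set Y) (g : F → Y → EdgeGroup Y),
      (∀ i, IsPotentialOn (g i) (K i)) ∧ (∀ y, ∃ i, y ∈ interior (K i)) ∧
        ∀ i j, ((fun x => g i x - g j x) '' (K i ∩ K j)).Finite := by
  choose U hUo hyU g hg using exists_isPotentialOn (Y := Y)
  choose K hK hyK hKU using fun y => exists_compact_subset (hUo y) (hyU y)
  obtain ⟨F, hF⟩ := CompactSpace.elim_nhds_subcover (fun y => interior (K y))
    (fun y => isOpen_interior.mem_nhds (hyK y))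
  refine ⟨F, fun y => K y, fun y => g y,
    fun y γ hγ => hg y γ (hγ.trans (hKU y)), fun x => ?_, fun y z => ?_⟩
  · have hx : x ∈ ⋃ y ∈ F, interior (K y) := hF ▸ Set.mem_univ x
    simpa using hx
  · exact (hg y).finite_image_sub (hg z) (hUo y) (hUo z) ((hK y).inter_right (hK z).isClosed)
      (Set.inter_subset_left.trans (hKU y)) (Set.inter_subset_right.trans (hKU z))

variable (Y) in
theorem exists_fg_sub_linearCombination_boundary_mem [CompactSpace Y] [T2Space Y]
    [StronglyLocallyContractibleSpace Y] :
    ∃ (g : Y → EdgeGroup Y) (N : Submodule ℤ (EdgeGroup Y)), N.FG ∧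
      ∀ q, q - Finsupp.linearCombination ℤ g (boundary Y q) ∈ N := by
  obtain ⟨F, K, g, hg, hcover, hfin⟩ := exists_compact_cover_with_potentials Y
  choose i hi using hcover
  let S : Set (EdgeGroup Y) := ⋃ j, ⋃ k, (fun x => g j x - g k x) '' (K j ∩ K k)
  have hS : S.Finite := Set.finite_iUnion fun j => Set.finite_iUnion fun k => hfin j k
  let g' : Y → EdgeGroup Y := fun x => g (i x) x
  have hsub : ∀ j, ∀ x ∈ K j, g j x - g' x ∈ Submodule.span ℤ S := fun j x hx =>
    Submodule.subset_span (Set.mem_iUnion₂.2 ⟨j, i x, x, ⟨hx, interior_subset (hi x)⟩, rfl⟩)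
  let r : Module.End ℤ (EdgeGroup Y) := LinearMap.id - Finsupp.linearCombination ℤ g' ∘ₗ boundary Y
  suffices hr : ⊤ ≤ (Submodule.span ℤ S).comap r from
    ⟨g', Submodule.span ℤ S, Submodule.fg_span hS, fun q => hr (Submodule.mem_top (x := q))⟩
  rw [← span_edge_of_isOpen_cover (fun j => isOpen_interior (s := K j)) fun y => ⟨i y, hi y⟩,
    Submodule.span_le]
  rintro _ ⟨γ, ⟨j, hγ⟩, rfl⟩
  have hγK := hγ.trans interior_subset
  have hrγ : r (edge γ) = (g j (γ 1) - g' (γ 1)) - (g j (γ 0) - g' (γ 0)) := by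
    simp only [r, LinearMap.sub_apply, LinearMap.id_apply, LinearMap.comp_apply, boundary_edge,
      map_sub, Finsupp.linearCombination_single, one_smul]
    rw [hg j γ hγK]
    abel
  rw [SetLike.mem_coe, Submodule.mem_comap, hrγ]
  exact sub_mem (hsub j _ (hγK ⟨1, rfl⟩)) (hsub j _ (hγK ⟨0, rfl⟩))

end EdgeGroup

end EdgeGeometry

/-! ### Coverings -/

section EdgeCovering

open unitInterval

instance : LocallyPathConnectedSpace (stdSimplex ℝ (Fin 3)) :=
  (convex_stdSimplex ℝ (Fin 3)).locallyPathConnectedSpace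

instance : ContractibleSpace (stdSimplex ℝ (Fin 3)) :=
  (convex_stdSimplex ℝ (Fin 3)).contractibleSpace ⟨_, single_mem_stdSimplex ℝ 0⟩

instance : LocallyPathConnectedSpace I := (convex_Icc (0 : ℝ) 1).locallyPathConnectedSpace

instance : ContractibleSpace I :=
  (convex_Icc (0 : ℝ) 1).contractibleSpace ⟨0, by simp⟩

namespace EdgeGroup

variable {E B X : Type*} [TopologicalSpace E] [TopologicalSpace B] [TopologicalSpace X]
  {π : C(E, X)} {ρ : C(B, X)} {f : C(E, B)}

theorem exists_comp_eq_of_isCoveringMap (hπ : IsCoveringMap π) (hρ : IsCoveringMap ρ)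
    (hf : ρ.comp f = π) {A : Type*} [TopologicalSpace A] [SimplyConnectedSpace A]
    [LocallyPathConnectedSpace A] {θ : C(A, B)} {a : A} {w : E} (hw : f w = θ a) :
    ∃ F : C(A, E), f.comp F = θ := by
  obtain ⟨F, ⟨hFa, hF⟩, -⟩ := hπ.existsUnique_continuousMap_lifts (ρ.comp θ) a w
    (by rw [← hf]; exact congrArg ρ hw)
  refine ⟨F, DFunLike.coe_injective
    (hρ.eq_of_comp_eq (f.comp F).continuous θ.continuous ?_ a ?_)⟩
  · rw [← hf] at hF
    exact hF
  · rw [ContinuousMap.comp_apply, hFa, hw]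

theorem surjective_of_isCoveringMap [Nonempty E] [PathConnectedSpace B] (hπ : IsCoveringMap π)
    (hρ : IsCoveringMap ρ) (hf : ρ.comp f = π) : Function.Surjective f := fun b => by
  obtain ⟨w⟩ := ‹Nonempty E›
  let γ := (PathConnectedSpace.joined (f w) b).somePath
  obtain ⟨Γ, hΓ⟩ := exists_comp_eq_of_isCoveringMap hπ hρ hf
    (θ := γ.toContinuousMap) (a := 0) γ.source.symm
  exact ⟨Γ 1, (DFunLike.congr_fun hΓ 1).trans γ.target⟩

theorem exists_comp_eq_of_surjective (hπ : IsCoveringMap π) (hρ : IsCoveringMap ρ)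
    (hf : ρ.comp f = π) (hsurj : Function.Surjective f) {A : Type*} [TopologicalSpace A]
    [SimplyConnectedSpace A] [LocallyPathConnectedSpace A] (θ : C(A, B)) :
    ∃ F : C(A, E), f.comp F = θ := by
  obtain ⟨a⟩ : Nonempty A := inferInstance
  obtain ⟨w, hw⟩ := hsurj (θ a)
  exact exists_comp_eq_of_isCoveringMap hπ hρ hf hw

theorem map_surjective_of_isCoveringMap (hπ : IsCoveringMap π) (hρ : IsCoveringMap ρ)
    (hf : ρ.comp f = π) (hsurj : Function.Surjective f) : Function.Surjective (map f) := by
  rw [← LinearMap.range_eq_top, eq_top_iff, ← span_range_edge, Submodule.span_le]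
  rintro _ ⟨γ, rfl⟩
  obtain ⟨Γ, rfl⟩ := exists_comp_eq_of_surjective hπ hρ hf hsurj γ
  exact ⟨edge Γ, map_edge f Γ⟩

theorem ker_map_le_of_isCoveringMap (hπ : IsCoveringMap π) (hρ : IsCoveringMap ρ)
    (hf : ρ.comp f = π) (hsurj : Function.Surjective f) {R : Submodule ℤ (EdgeGroup E)}
    (hR : ∀ Γ Γ' : C(I, E), f.comp Γ = f.comp Γ' → edge Γ - edge Γ' ∈ R) :
    LinearMap.ker (map f) ≤ R := by
  have hmkQ : ∀ Γ Γ' : C(I, E), f.comp Γ = f.comp Γ' → R.mkQ (edge Γ) = R.mkQ (edge Γ') :=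
    fun Γ Γ' h => (Submodule.Quotient.eq R).2 (hR Γ Γ' h)
  choose Λ hΛ using exists_comp_eq_of_surjective (A := I) hπ hρ hf hsurj
  -- Lifting paths and triangles inverts `map f` modulo `R`.
  let φ : EdgeGroup B →ₗ[ℤ] EdgeGroup E ⧸ R := lift (fun γ => R.mkQ (edge (Λ γ))) fun τ => by
    obtain ⟨T, rfl⟩ := exists_comp_eq_of_surjective hπ hρ hf hsurj τ
    have hface : ∀ i, R.mkQ (edge (Λ ((f.comp T).comp (triangleFace i)))) =
        R.mkQ (edge (T.comp (triangleFace i))) := fun i =>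
      hmkQ _ _ (by rw [hΛ, ContinuousMap.comp_assoc])
    rw [hface, hface, hface, ← map_add, edge_triangle]
  have hφ : φ ∘ₗ map f = R.mkQ := hom_ext fun γ => by
    rw [LinearMap.comp_apply, map_edge, lift_edge]
    exact hmkQ _ _ (hΛ _)
  rw [← R.ker_mkQ, ← hφ]
  exact LinearMap.ker_le_ker_comp _ _

theorem exact_map_sub_one_map (hπ : IsCoveringMap π) (hρ : IsCoveringMap ρ)
    (hf : ρ.comp f = π) (hsurj : Function.Surjective f) {s : C(E, E)} (hs : f.comp s = f)
    (htrans : ∀ w w', f w = f w' → ∃ d : C(E, E), d w = w' ∧ f.comp d = f ∧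
      LinearMap.range (map d - 1 : Module.End ℤ (EdgeGroup E)) ≤ LinearMap.range (map s - 1)) :
    Function.Exact (map s - 1 : Module.End ℤ (EdgeGroup E)) (map f) := by
  rw [LinearMap.exact_iff]
  refine le_antisymm (ker_map_le_of_isCoveringMap hπ hρ hf hsurj fun Γ Γ' h => ?_) ?_
  · obtain ⟨d, hd, hfd, hrange⟩ := htrans (Γ' 0) (Γ 0) (DFunLike.congr_fun h 0).symm
    have hπd : π.comp (d.comp Γ') = π.comp Γ := by
      rw [← hf, ContinuousMap.comp_assoc, ContinuousMap.comp_assoc, h,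
        ← ContinuousMap.comp_assoc f, hfd]
    obtain rfl : d.comp Γ' = Γ := DFunLike.coe_injective (hπ.eq_of_comp_eq
      (d.comp Γ').continuous Γ.continuous (congrArg DFunLike.coe hπd) 0 hd)
    rw [← map_edge]
    exact hrange ⟨edge Γ', rfl⟩
  · rw [LinearMap.range_le_ker_iff, Module.End.one_eq_id, LinearMap.comp_sub, LinearMap.comp_id,
      ← map_comp, hs, sub_self]

end EdgeGroup

/-- A choice of paths from all points to a base point, constant at the base point. -/
structure PathSystem (X : Type*) [TopologicalSpace X] where
  /-- the base point -/
  base : X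
  /-- the chosen path to the base point -/
  path : ∀ x, Path x base
  path_base : path base = Path.refl base

theorem nonempty_pathSystem (X : Type*) [TopologicalSpace X] [PathConnectedSpace X] :
    Nonempty (PathSystem X) := by
  classical
  obtain ⟨x₀⟩ : Nonempty X := inferInstance
  exact ⟨⟨x₀, fun x => if h : x = x₀ then (Path.refl x₀).cast h rfl else
    (PathConnectedSpace.joined x x₀).some, by simp⟩⟩

namespace EdgeGroup

variable {E B X : Type*} [TopologicalSpace E] [TopologicalSpace B] [TopologicalSpace X]
  {π : C(E, X)} {ρ : C(B, X)} {f : C(E, B)} (c : PathSystem X) (hπ : IsCoveringMap π)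
  (hρ : IsCoveringMap ρ)

/-- The lift of a chosen path of the base, from a point of the covering space to the fibre over the
base point. -/
noncomputable def liftedPath (y : E) : C(I, E) :=
  hπ.liftPath (c.path (π y)) y (c.path _).source

theorem liftedPath_zero (y : E) : liftedPath c hπ y 0 = y := hπ.liftPath_zero _ _ _

theorem proj_liftedPath_one (y : E) : π (liftedPath c hπ y 1) = c.base :=
  (congrFun (hπ.liftPath_lifts (c.path (π y)) y (c.path _).source) 1).trans (c.path _).target

theorem liftedPath_of_proj_eq {y : E} (hy : π y = c.base) :
    liftedPath c hπ y = ContinuousMap.const I y := by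
  symm
  refine (hπ.eq_liftPath_iff' _).2 ⟨?_, rfl⟩
  ext t
  have hpath : ∀ x, x = c.base → c.path x t = x := by
    rintro _ rfl
    rw [c.path_base, Path.refl_apply]
  exact (hpath _ hy).symm

theorem comp_liftedPath (hf : ρ.comp f = π) (y : E) :
    f.comp (liftedPath c hπ y) = liftedPath c hρ (f y) := by
  subst hf
  refine (hρ.eq_liftPath_iff' _).2 ⟨hπ.liftPath_lifts _ y (c.path _).source, ?_⟩
  rw [ContinuousMap.comp_apply, liftedPath_zero]

/-- The projection of the edge group to the classes of chains whose boundary lies in the fibre over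
the base point, obtained by moving end points along the lifted paths. -/
noncomputable def retraction : Module.End ℤ (EdgeGroup E) :=
  1 + Finsupp.linearCombination ℤ (fun y => edge (liftedPath c hπ y)) ∘ₗ boundary E

theorem retraction_apply (q : EdgeGroup E) : retraction c hπ q =
    q + Finsupp.linearCombination ℤ (fun y => edge (liftedPath c hπ y)) (boundary E q) := rfl

theorem retraction_edge (γ : C(I, E)) : retraction c hπ (edge γ) =
    edge γ + (edge (liftedPath c hπ (γ 1)) - edge (liftedPath c hπ (γ 0))) := by
  rw [retraction_apply, boundary_edge, map_sub, Finsupp.linearCombination_single,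
    Finsupp.linearCombination_single, one_smul, one_smul]

theorem boundary_retraction_edge (γ : C(I, E)) : boundary E (retraction c hπ (edge γ)) =
    Finsupp.single (liftedPath c hπ (γ 1) 1) 1 - Finsupp.single (liftedPath c hπ (γ 0) 1) 1 := by
  rw [retraction_edge, map_add, map_sub]
  simp only [boundary_edge, liftedPath_zero]
  abel

theorem isIdempotentElem_retraction : IsIdempotentElem (retraction c hπ) :=
  hom_ext fun γ => by
    rw [Module.End.mul_apply, retraction_apply _ _ (retraction c hπ (edge γ)),
      boundary_retraction_edge, map_sub]
    simp [liftedPath_of_proj_eq c hπ (proj_liftedPath_one c hπ _), edge_const]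

theorem retraction_of_boundary_eq_zero {q : EdgeGroup E} (hq : boundary E q = 0) :
    retraction c hπ q = q := by
  rw [retraction_apply, hq, map_zero, add_zero]

theorem map_comp_retraction (hf : ρ.comp f = π) :
    map f ∘ₗ retraction c hπ = retraction c hρ ∘ₗ map f :=
  hom_ext fun γ => by
    rw [LinearMap.comp_apply, LinearMap.comp_apply, retraction_edge, map_edge, retraction_edge,
      map_add, map_sub, map_edge, map_edge, map_edge, comp_liftedPath c hπ hρ hf,
      comp_liftedPath c hπ hρ hf]
    rfl

theorem finite_range_retraction [CompactSpace E] [T2Space E] [StronglyLocallyContractibleSpace E]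
    (hfib : (π ⁻¹' {c.base}).Finite) : Module.Finite ℤ (LinearMap.range (retraction c hπ)) := by
  obtain ⟨g, N, hN, hgN⟩ := exists_fg_sub_linearCombination_boundary_mem E
  let T := N ⊔ Submodule.span ℤ (g '' (π ⁻¹' {c.base}))
  have hT : T.FG := hN.sup (Submodule.fg_span (hfib.image g))
  have hle : LinearMap.range (retraction c hπ) ≤ T := by
    rw [LinearMap.range_eq_map, ← span_range_edge, Submodule.map_span_le]
    rintro _ ⟨γ, rfl⟩
    have hend : ∀ y, g (liftedPath c hπ y 1) ∈ T := fun y => le_sup_right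
      (a := N) (Submodule.subset_span ⟨_, proj_liftedPath_one c hπ y, rfl⟩)
    have hboundary : Finsupp.linearCombination ℤ g (boundary E (retraction c hπ (edge γ))) ∈ T := by
      rw [boundary_retraction_edge, map_sub]
      simpa using sub_mem (hend (γ 1)) (hend (γ 0))
    simpa using add_mem (le_sup_left (a := N) (hgN (retraction c hπ (edge γ)))) hboundary
  have := isNoetherian_of_fg_of_noetherian T hT
  have := isNoetherian_of_le hle
  infer_instance

end EdgeGroup

end EdgeCovering

/-! ### Quotient coverings -/

section QuotientCovering

theorem t2Space_of_isCoveringMap {E X : Type*} [TopologicalSpace E] [TopologicalSpace X]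
    [T2Space X] {π : E → X} (hπ : IsCoveringMap π) : T2Space E := by
  refine ⟨fun w w' hne => ?_⟩
  by_cases h : π w = π w'
  · exact hπ.isSeparatedMap w w' h hne
  · exact separated_by_continuous hπ.continuous h

variable {E B X G H : Type*} [TopologicalSpace E] [TopologicalSpace B] [TopologicalSpace X]
  [AddGroup G] [AddAction G E] [AddGroup H] [AddAction H B]
  {π : C(E, X)} {ρ : C(B, X)} {f : C(E, B)}

theorem finite_preimage_singleton_of_quotientCovering [Finite G]
    (hπ : IsAddQuotientCoveringMap π G) (x : X) : (π ⁻¹' {x}).Finite := by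
  obtain ⟨w, rfl⟩ := hπ.surjective x
  exact (Set.finite_range fun a : G => a +ᵥ w).subset fun _ => hπ.apply_eq_iff_mem_orbit.1

theorem isClosedMap_of_quotientCovering [Finite G] (hπ : IsAddQuotientCoveringMap π G) :
    IsClosedMap π := fun F hF => by
  have hpreimage : π ⁻¹' (π '' F) = ⋃ a : G, (a +ᵥ ·) ⁻¹' F := by
    ext w
    simp only [Set.mem_preimage, Set.mem_image, Set.mem_iUnion]
    constructor
    · rintro ⟨w', hw', h⟩
      obtain ⟨a, rfl⟩ := hπ.apply_eq_iff_mem_orbit.1 h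
      exact ⟨a, hw'⟩
    · rintro ⟨a, ha⟩
      exact ⟨_, ha, hπ.map_vadd a⟩
  rw [← hπ.isClosed_preimage, hpreimage]
  exact isClosed_iUnion_of_finite fun a => hF.preimage (hπ.continuous_const_vadd a)

theorem compactSpace_of_quotientCovering [Finite G] [CompactSpace X]
    (hπ : IsAddQuotientCoveringMap π G) : CompactSpace E := by
  have hproper : IsProperMap π := isProperMap_iff_isClosedMap_and_compact_fibers.2
    ⟨π.continuous, isClosedMap_of_quotientCovering hπ,
      fun x => (finite_preimage_singleton_of_quotientCovering hπ x).isCompact⟩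
  exact ⟨by simpa using hproper.isCompact_preimage isCompact_univ⟩

/-- The deck transformation of a quotient covering space given by an element of the group. -/
def deckMap (hπ : IsAddQuotientCoveringMap π G) (a : G) : C(E, E) :=
  ⟨(a +ᵥ ·), hπ.continuous_const_vadd a⟩

theorem deckMap_zero (hπ : IsAddQuotientCoveringMap π G) :
    deckMap hπ 0 = ContinuousMap.id E :=
  ContinuousMap.ext fun w => zero_vadd G w

theorem deckMap_add (hπ : IsAddQuotientCoveringMap π G) (a b : G) :
    deckMap hπ (a + b) = (deckMap hπ a).comp (deckMap hπ b) :=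
  ContinuousMap.ext fun w => add_vadd a b w

theorem comp_deckMap (hπ : IsAddQuotientCoveringMap π G) (a : G) :
    π.comp (deckMap hπ a) = π :=
  ContinuousMap.ext fun _ => hπ.map_vadd a

theorem map_deckMap_pow (hπ : IsAddQuotientCoveringMap π G) (a : G) (k : ℕ) :
    (EdgeGroup.map (deckMap hπ a) : Module.End ℤ (EdgeGroup E)) ^ k =
      EdgeGroup.map (deckMap hπ (k • a)) := by
  induction k with
  | zero => rw [zero_nsmul, deckMap_zero, EdgeGroup.map_id, pow_zero, Module.End.one_eq_id]
  | succ k ih =>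
    rw [pow_succ, ih, succ_nsmul, deckMap_add, EdgeGroup.map_comp, Module.End.mul_eq_comp]

theorem exists_comp_deckMap_eq [ConnectedSpace E] (hπ : IsAddQuotientCoveringMap π G)
    (hρ : IsAddQuotientCoveringMap ρ H) (hf : ρ.comp f = π) (a : G) :
    ∃ h : H, f.comp (deckMap hπ a) = (deckMap hρ h).comp f := by
  obtain ⟨w₀⟩ : Nonempty E := inferInstance
  have hproj : ρ.comp (f.comp (deckMap hπ a)) = ρ.comp f := by
    rw [← ContinuousMap.comp_assoc, hf, comp_deckMap]
  obtain ⟨h, hh⟩ := hρ.apply_eq_iff_mem_orbit.1 (DFunLike.congr_fun hproj w₀)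
  have hproj' : ρ.comp (f.comp (deckMap hπ a)) = ρ.comp ((deckMap hρ h).comp f) := by
    rw [hproj, ← ContinuousMap.comp_assoc, comp_deckMap]
  exact ⟨h, DFunLike.coe_injective (hρ.isCoveringMap.eq_of_comp_eq
    (ContinuousMap.continuous _) (ContinuousMap.continuous _)
    (congrArg DFunLike.coe hproj') w₀ hh.symm)⟩

theorem exists_addMonoidHom_comp_deckMap_eq [ConnectedSpace E]
    (hπ : IsAddQuotientCoveringMap π G) (hρ : IsAddQuotientCoveringMap ρ H)
    (hf : ρ.comp f = π) :
    ∃ ψ : G →+ H, ∀ a, f.comp (deckMap hπ a) = (deckMap hρ (ψ a)).comp f := by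
  choose ψ hψ using exists_comp_deckMap_eq hπ hρ hf
  have hcancel := hρ.isCancelVAdd
  obtain ⟨w₀⟩ : Nonempty E := inferInstance
  refine ⟨AddMonoidHom.mk' ψ fun a b => IsCancelVAdd.right_cancel _ _ (f w₀) ?_, hψ⟩
  have hcomp : (deckMap hρ (ψ (a + b))).comp f = (deckMap hρ (ψ a + ψ b)).comp f := by
    rw [← hψ, deckMap_add, deckMap_add, ← ContinuousMap.comp_assoc, hψ a,
      ContinuousMap.comp_assoc, hψ b, ContinuousMap.comp_assoc]
  exact DFunLike.congr_fun hcomp w₀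

variable {ψ : G →+ H}

theorem exists_deckMap_eq_of_apply_eq_vadd (hπ : IsAddQuotientCoveringMap π G)
    (hρ : IsAddQuotientCoveringMap ρ H) (hf : ρ.comp f = π)
    (hψ : ∀ a, f.comp (deckMap hπ a) = (deckMap hρ (ψ a)).comp f) {w w' : E} {h : H}
    (hw : f w' = h +ᵥ f w) : ∃ a, ψ a = h ∧ deckMap hπ a w = w' := by
  have hproj : π w' = π w := by
    rw [← hf, ContinuousMap.comp_apply, ContinuousMap.comp_apply, hw, hρ.map_vadd]
  obtain ⟨a, rfl⟩ := hπ.apply_eq_iff_mem_orbit.1 hproj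
  have hcancel := hρ.isCancelVAdd
  exact ⟨a, IsCancelVAdd.right_cancel _ _ (f w)
    ((DFunLike.congr_fun (hψ a) w).symm.trans hw), rfl⟩

theorem surjective_of_comp_deckMap_eq [Nonempty E] (hπ : IsAddQuotientCoveringMap π G)
    (hρ : IsAddQuotientCoveringMap ρ H) (hf : ρ.comp f = π) (hsurj : Function.Surjective f)
    (hψ : ∀ a, f.comp (deckMap hπ a) = (deckMap hρ (ψ a)).comp f) : Function.Surjective ψ := by
  intro h
  obtain ⟨w₀⟩ := ‹Nonempty E›
  obtain ⟨w, hw⟩ := hsurj (h +ᵥ f w₀)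
  obtain ⟨a, ha, -⟩ := exists_deckMap_eq_of_apply_eq_vadd hπ hρ hf hψ hw
  exact ⟨a, ha⟩

theorem EdgeGroup.exact_map_deckMap_sub_one_map (hπ : IsAddQuotientCoveringMap π G)
    (hρ : IsAddQuotientCoveringMap ρ H) (hf : ρ.comp f = π) (hsurj : Function.Surjective f)
    (hψ : ∀ a, f.comp (deckMap hπ a) = (deckMap hρ (ψ a)).comp f) {b : G}
    (hb : ∀ a, ψ a = 0 ↔ ∃ k : ℕ, a = k • b) :
    Function.Exact (map (deckMap hπ b) - 1 : Module.End ℤ (EdgeGroup E)) (map f) := by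
  have hcomp : ∀ a, ψ a = 0 → f.comp (deckMap hπ a) = f := fun a ha => by
    rw [hψ, ha, deckMap_zero, ContinuousMap.id_comp]
  refine exact_map_sub_one_map hπ.isCoveringMap hρ.isCoveringMap hf hsurj
    (hcomp b ((hb b).2 ⟨1, (one_nsmul b).symm⟩)) fun w w' hww' => ?_
  obtain ⟨a, ha, haw⟩ := exists_deckMap_eq_of_apply_eq_vadd hπ hρ hf hψ
    (hww'.symm.trans (zero_vadd H (f w)).symm)
  refine ⟨deckMap hπ a, haw, hcomp a ha, ?_⟩
  obtain ⟨k, rfl⟩ := (hb a).1 ha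
  rw [← map_deckMap_pow, ← mul_geom_sum, Module.End.mul_eq_comp]
  exact LinearMap.range_comp_le_range _ _

end QuotientCovering

section CyclicTower

theorem zmod_hom_apply {m n : ℕ} [NeZero m] (h : n ∣ m) (ψ : ZMod m →+ ZMod n) (x : ZMod m) :
    ψ x = ZMod.castHom h (ZMod n) x * ψ 1 := by
  obtain ⟨k, rfl⟩ := ZMod.natCast_zmod_surjective x
  rw [map_natCast (ZMod.castHom h (ZMod n)), ← nsmul_one, map_nsmul, nsmul_eq_mul]

theorem isUnit_zmod_hom_one {m n : ℕ} [NeZero m] (h : n ∣ m) {ψ : ZMod m →+ ZMod n}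
    (hψ : Function.Surjective ψ) : IsUnit (ψ 1) := by
  obtain ⟨x, hx⟩ := hψ 1
  rw [zmod_hom_apply h] at hx
  exact IsUnit.of_mul_eq_one_right _ hx

theorem exists_unit_zmod_hom_eq {m n : ℕ} [NeZero m] (h : n ∣ m) {ψ : ZMod m →+ ZMod n}
    (hψ : Function.Surjective ψ) (u : (ZMod n)ˣ) : ∃ v : (ZMod m)ˣ, ψ v = u := by
  obtain ⟨c, hc⟩ := isUnit_zmod_hom_one h hψ
  obtain ⟨v, hv⟩ := ZMod.unitsMap_surjective h (u * c⁻¹)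
  have hcast : ZMod.castHom h (ZMod n) (v : ZMod m) = u * (c⁻¹ : (ZMod n)ˣ) := by
    rw [← Units.val_mul, ← hv, ZMod.unitsMap_def, Units.coe_map]
    rfl
  exact ⟨v, by rw [zmod_hom_apply h, hcast, ← hc, Units.inv_mul_cancel_right]⟩

theorem exists_units_zmod_hom_eq {m : ℕ → ℕ} [∀ n, NeZero (m n)] (h : ∀ n, m n ∣ m (n + 1))
    {ψ : ∀ n, ZMod (m (n + 1)) →+ ZMod (m n)} (hψ : ∀ n, Function.Surjective (ψ n)) :
    ∃ u : ∀ n, (ZMod (m n))ˣ, ∀ n, ψ n (u (n + 1)) = u n := by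
  choose next hnext using fun n => exists_unit_zmod_hom_eq (h n) (hψ n)
  exact ⟨fun n => Nat.rec 1 next n, fun n => hnext n _⟩

theorem zmod_hom_eq_zero_iff {m n : ℕ} [NeZero m] (h : n ∣ m) {ψ : ZMod m →+ ZMod n}
    (hψ : Function.Surjective ψ) (u : (ZMod m)ˣ) (a : ZMod m) :
    ψ a = 0 ↔ ∃ k : ℕ, a = k • (n • (u : ZMod m)) := by
  rw [zmod_hom_apply h, (isUnit_zmod_hom_one h hψ).mul_left_eq_zero]
  constructor
  · intro hcast
    obtain ⟨m', rfl⟩ := ZMod.natCast_zmod_surjective a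
    rw [map_natCast, ZMod.natCast_eq_zero_iff] at hcast
    obtain ⟨j, rfl⟩ := hcast
    obtain ⟨k, hk⟩ := ZMod.natCast_zmod_surjective ((j : ZMod m) * ((u⁻¹ : (ZMod m)ˣ) : ZMod m))
    refine ⟨k, ?_⟩
    rw [nsmul_eq_mul, nsmul_eq_mul, hk, mul_left_comm, Units.inv_mul_cancel_right, Nat.cast_mul]
  · rintro ⟨k, rfl⟩
    rw [map_nsmul, map_nsmul, nsmul_eq_mul n, ZMod.natCast_self, zero_mul, smul_zero]

end CyclicTower

/-! ### Local contractibility -/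

section LocallyContractible

theorem stronglyLocallyContractibleSpace_of_convex {V : Type*} [AddCommGroup V] [Module ℝ V]
    [TopologicalSpace V] [IsTopologicalAddGroup V] [ContinuousSMul ℝ V] [LocallyConvexSpace ℝ V]
    {S : Set V} (hS : Convex ℝ S) : StronglyLocallyContractibleSpace S := by
  have hbasis : ∀ x : S, (𝓝 x).HasBasis (fun K => K ∈ 𝓝 (x : V) ∧ Convex ℝ K)
      (Subtype.val ⁻¹' ·) := fun x => by
    rw [nhds_induced]
    exact (LocallyConvexSpace.convex_basis (𝕜 := ℝ) (x : V)).comap _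
  refine .of_bases hbasis fun x K hK => ?_
  have : ContractibleSpace (K ∩ S : Set V) :=
    (hK.2.inter hS).contractibleSpace ⟨x, mem_of_mem_nhds hK.1, x.2⟩
  exact (IsEmbedding.subtypeVal.homeomorphImage (Subtype.val ⁻¹' K)).contractibleSpace_iff.2
    (by rwa [Subtype.image_preimage_coe, Set.inter_comm])

instance {n : ℕ} [NeZero n] : StronglyLocallyContractibleSpace (EuclideanHalfSpace n) :=
  stronglyLocallyContractibleSpace_of_convex EuclideanHalfSpace.convex

variable {Y Z : Type*} [TopologicalSpace Y] [TopologicalSpace Z]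

theorem stronglyLocallyContractibleSpace_of_forall_exists_mem_source
    [StronglyLocallyContractibleSpace Z]
    (h : ∀ y : Y, ∃ e : OpenPartialHomeomorph Y Z, y ∈ e.source) :
    StronglyLocallyContractibleSpace Y where
  contractible_basis y := by
    refine hasBasis_self.2 fun t ht => ?_
    obtain ⟨e, hy⟩ := h y
    have := e.isOpenEmbedding_restrict.stronglyLocallyContractibleSpace
    obtain ⟨s, ⟨hs, hsc⟩, hst⟩ := (contractible_basis (⟨y, hy⟩ : e.source)).mem_iff.1
      (continuous_subtype_val.continuousAt.preimage_mem_nhds ht)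
    exact ⟨Subtype.val '' s, e.open_source.isOpenEmbedding_subtypeVal.image_mem_nhds.2 hs,
      (IsEmbedding.subtypeVal.homeomorphImage s).contractibleSpace_iff.1 hsc,
      Set.image_subset_iff.2 hst⟩

theorem stronglyLocallyContractibleSpace_of_isCoveringMap [StronglyLocallyContractibleSpace Z]
    {π : Y → Z} (hπ : IsCoveringMap π) : StronglyLocallyContractibleSpace Y :=
  stronglyLocallyContractibleSpace_of_forall_exists_mem_source fun y =>
    (hπ.isLocalHomeomorph y).imp fun _ => And.left

theorem stronglyLocallyContractibleSpace_of_chartedSpace (H M : Type*) [TopologicalSpace H]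
    [TopologicalSpace M] [ChartedSpace H M] [StronglyLocallyContractibleSpace H] :
    StronglyLocallyContractibleSpace M :=
  stronglyLocallyContractibleSpace_of_forall_exists_mem_source fun x =>
    ⟨chartAt H x, mem_chart_source H x⟩

end LocallyContractible

/-! ### Cyclic towers of coverings -/

namespace ZpCover

theorem connectedSpace {p : ℕ} {X : Type u} [TopologicalSpace X] (C : ZpCover p X) :
    ConnectedSpace X :=
  have := C.connected 0
  (C.isCover 0).surjective.connectedSpace (C.proj 0).continuous

variable {p : ℕ} {X : Type u} [TopologicalSpace X] (C : ZpCover p X)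

instance (n : ℕ) : AddAction (ZMod (p ^ n)) (C.space n) := C.action n

instance (n : ℕ) : ConnectedSpace (C.space n) := C.connected n

theorem isCoveringMap (n : ℕ) : IsCoveringMap (C.proj n) := (C.isCover n).isCoveringMap

theorem trans_surjective [StronglyLocallyContractibleSpace X] (n : ℕ) :
    Function.Surjective (C.trans n) := by
  have := stronglyLocallyContractibleSpace_of_isCoveringMap (C.isCoveringMap n)
  have : PathConnectedSpace (C.space n) := pathConnectedSpace_iff_connectedSpace.2 inferInstance
  exact EdgeGroup.surjective_of_isCoveringMap (C.isCoveringMap (n + 1)) (C.isCoveringMap n)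
    (C.proj_trans n)

theorem exists_isCoinvariantTower [Fact p.Prime] [StronglyLocallyContractibleSpace X] :
    ∃ u : ∀ n, ZMod (p ^ n), IsCoinvariantTower p
      (fun n => EdgeGroup.map (deckMap (C.isCover n) (u n)))
      fun n => EdgeGroup.map (C.trans n) := by
  choose ψ hψ using fun n =>
    exists_addMonoidHom_comp_deckMap_eq (C.isCover (n + 1)) (C.isCover n) (C.proj_trans n)
  have hψ_surj : ∀ n, Function.Surjective (ψ n) := fun n =>
    surjective_of_comp_deckMap_eq (C.isCover (n + 1)) (C.isCover n) (C.proj_trans n)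
      (C.trans_surjective n) (hψ n)
  have hdvd : ∀ n, p ^ n ∣ p ^ (n + 1) := fun n => pow_dvd_pow p n.le_succ
  obtain ⟨u, hu⟩ := exists_units_zmod_hom_eq hdvd hψ_surj
  refine ⟨fun n => u n, fun n => ?_, fun n => ?_, fun n => ?_, fun n => ?_⟩
  · rw [map_deckMap_pow, nsmul_eq_mul, ZMod.natCast_self, zero_mul, deckMap_zero,
      EdgeGroup.map_id, Module.End.one_eq_id]
  · exact EdgeGroup.map_surjective_of_isCoveringMap (C.isCoveringMap (n + 1))
      (C.isCoveringMap n) (C.proj_trans n) (C.trans_surjective n)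
  · rw [← EdgeGroup.map_comp, ← EdgeGroup.map_comp, hψ, hu]
  · rw [map_deckMap_pow]
    exact EdgeGroup.exact_map_deckMap_sub_one_map (C.isCover (n + 1)) (C.isCover n)
      (C.proj_trans n) (C.trans_surjective n) (hψ n)
      (zmod_hom_eq_zero_iff (hdvd n) (hψ_surj n) (u (n + 1)))

theorem finite_range_retraction [Fact p.Prime] [T2Space X] [CompactSpace X]
    [StronglyLocallyContractibleSpace X] (c : PathSystem X) (n : ℕ) :
    Module.Finite ℤ (LinearMap.range (EdgeGroup.retraction c (C.isCoveringMap n))) := by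
  have := t2Space_of_isCoveringMap (C.isCoveringMap n)
  have := compactSpace_of_quotientCovering (C.isCover n)
  have := stronglyLocallyContractibleSpace_of_isCoveringMap (C.isCoveringMap n)
  exact EdgeGroup.finite_range_retraction c _
    (finite_preimage_singleton_of_quotientCovering (C.isCover n) c.base)

theorem torsionOrdersConverge_edgeGroup [Fact p.Prime] [T2Space X] [CompactSpace X]
    [StronglyLocallyContractibleSpace X] :
    TorsionOrdersConverge p fun n => EdgeGroup (C.space n) := by
  have := C.connectedSpace
  have : PathConnectedSpace X := pathConnectedSpace_iff_connectedSpace.2 inferInstance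
  obtain ⟨c⟩ := nonempty_pathSystem X
  obtain ⟨u, htower⟩ := C.exists_isCoinvariantTower
  have := C.finite_range_retraction c
  have hrange : TorsionOrdersConverge p fun n =>
      LinearMap.range (EdgeGroup.retraction c (C.isCoveringMap n)) :=
    (htower.restrict_range (fun n => EdgeGroup.isIdempotentElem_retraction c _)
      (fun n => EdgeGroup.map_comp_retraction c _ _ (comp_deckMap (C.isCover n) (u n)))
      fun n => EdgeGroup.map_comp_retraction c _ _ (C.proj_trans n)).torsionOrdersConverge
  refine (torsionOrdersConverge_iff_of_injective
    (j := fun n => (LinearMap.range _).subtype.toAddMonoidHom)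
    (fun n => Subtype.val_injective) fun n q hq => ?_).1 hrange
  exact ⟨⟨q, q, EdgeGroup.retraction_of_boundary_eq_zero c _
    (EdgeGroup.boundary_eq_zero_of_mem_torsion hq)⟩, rfl⟩

end ZpCover

theorem theorem3p1_general (p : ℕ) [Fact p.Prime] (X : Type u) [TopologicalSpace X] [T2Space X]
    [CompactSpace X] [StronglyLocallyContractibleSpace X] (C : ZpCover p X) :
    TorsionOrdersConverge p fun n => H1 (C.space n) := by
  choose j hj hrange using fun n => exists_injective_H1_edgeGroup (C.space n)
  exact (torsionOrdersConverge_iff_of_injective hj hrange).2 C.torsionOrdersConverge_edgeGroup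

theorem theorem3p1 (p : ℕ) [Fact p.Prime]
    (X : Type u) [TopologicalSpace X] [T2Space X] [CompactSpace X]
    [ChartedSpace (EuclideanHalfSpace 3) X] (C : ZpCover p X) :
    (∀ n, Finite (AddCommGroup.torsion (H1 (C.space n)))) ∧
    (∃ a : ℤ_[p], Tendsto
      (fun n => (Nat.card (AddCommGroup.torsion (H1 (C.space n))) : ℤ_[p])) atTop (𝓝 a)) ∧
    (∃ a : ℤ_[p], Tendsto
      (fun n => (Nat.card (nonPTorsion (H1 (C.space n)) p) : ℤ_[p])) atTop (𝓝 a)) ∧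
    (∀ l : ℕ, l.Prime → ∃ a : ℤ_[p], Tendsto
      (fun n => (Nat.card (AddCommGroup.primaryComponent (H1 (C.space n)) l) : ℤ_[p]))
        atTop (𝓝 a)) := by
  have := stronglyLocallyContractibleSpace_of_chartedSpace (EuclideanHalfSpace 3) X
  have h := theorem3p1_general p X C
  exact ⟨h.finite, h.torsion, h.nonPTorsion, h.primaryComponent⟩
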